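/- Let $E_1,E_2,\dots$ be independent standard exponential random variables, let $\gamma>0$, let $f:\{0,1,2,\dots\}\to\mathbb{R}$ be (strictly) increasing with $f(0)=0$, put $\Delta f(j)=f(j)-f(j-1)$ for $j\ge 1$, and let $\alpha(k)$, $k\ge1$, be positive real numbers. For $1\le j<k$ put $S_{j,k}=\exp\bigl(-\gamma\sum_{h=j}^{k-1}E_h/h\bigr)$ and $$S_k^*=\alpha(k)\sum_{j=1}^{k-1}\Delta f(j)\,\bigl[S_{j,k}-\mathbb{E}S_{j,k}\bigr].$$ Suppose that for some $\delta$ with $0<\delta<3$, with $\nu=(1-\delta)/2$, and for some integers $L\ge1$ and $q_0$ with $L\le q_0^2$, the following conditions hold: $$\sup_{k\ge L}\frac{\alpha^2(k)}{k^{2\gamma+1+\nu}}\sum_{j=L}^{k-1}(\Delta f(j))^2j^{2\gamma}<\infty,\tag{1}$$ $$\sup_{k\ge L}\frac{\alpha^2(k)}{k^{1+\nu}}\sum_{j=L+1}^{k-1}\Bigl[\sum_{i=L}^{j-1}\Delta f(i)\Bigr]\Delta f(j)\frac1j<\infty,\tag{2}$$ $$\sup_{k\ge L}\frac{\alpha^2(k)}{k^{1+\nu}}\sum_{j=L}^{k-1}\frac{\Delta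 f(j)}{j}<\infty,\tag{2m}$$ $$\sup_{q\ge q_0}\ \sup_{q^2+1\le k\le (q+1)^2}\frac{1}{q^{3-\delta}}\sum_{i=1}^{2q+1}\alpha^2(k)\,(\Delta f(q^2+i))^2\Bigl(\frac{q^2+i}{k}\Bigr)^{2\gamma}<\infty,\tag{3}$$ $$\sup_{q\ge q_0}\ \sup_{q^2+1\le k\le (q+1)^2}\frac{\alpha^2(k)}{q^{3-\delta}}\sum_{j=2}^{2q+1}\Bigl[\sum_{i=1}^{j-1}\Delta f(q^2+i)\Bigr]\Delta f(q^2+j)\frac{1}{q^2+j}<\infty.\tag{4}$$ Then $S_k^*/k\to0$ almost surely as $k\to\infty$. Moreover, if $$\mu_k=\frac1k\sum_{j=1}^{k-1}\alpha(k)\,\Delta f(j)\,\mathbb{E}S_{j,k}\longrightarrow\mu$$ as $k\to\infty$ for some finite $\mu$, then $$\frac1k\sum_{j=1}^{k-1}\alpha(k)\,\Delta f(j)\,S_{j,k}\longrightarrow\mu\quad\text{almost surely.}$$ -/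

import Mathlib

open Filter Topology MeasureTheory ProbabilityTheory

noncomputable section

/-- The increment `Δf(j) = f(j) - f(j-1)`; it is only used for `j ≥ 1`. -/
def incr (f : ℕ → ℝ) (j : ℕ) : ℝ := f j - f (j - 1)

/-- The random variable `S_{j,k} = exp (-γ ∑_{h=j}^{k-1} E_h / h)`. -/
def expSum {Ω : Type*} (γ : ℝ) (E : ℕ → Ω → ℝ) (j k : ℕ) (ω : Ω) : ℝ :=
  Real.exp (-γ * ∑ h ∈ Finset.Ico j k, E h ω / (h : ℝ))

/-- The weighted centered sum
`S*_k = ∑_{j=1}^{k-1} Δf(j) [S_{j,k} - 𝔼 S_{j,k}] α(k)`. -/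
def SStar {Ω : Type*} [MeasurableSpace Ω] (P : Measure Ω) (γ : ℝ) (f α : ℕ → ℝ)
    (E : ℕ → Ω → ℝ) (k : ℕ) (ω : Ω) : ℝ :=
  ∑ j ∈ Finset.Ico 1 k,
    incr f j * (expSum γ E j k ω - ∫ ω', expSum γ E j k ω' ∂P) * α k

/-- The uncentered normalized sum `k⁻¹ ∑_{j=1}^{k-1} α(k) Δf(j) S_{j,k}`. -/
def uncenteredMean {Ω : Type*} (γ : ℝ) (f α : ℕ → ℝ) (E : ℕ → Ω → ℝ) (k : ℕ) (ω : Ω) : ℝ :=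
  (k : ℝ)⁻¹ * ∑ j ∈ Finset.Ico 1 k, α k * incr f j * expSum γ E j k ω

/-- The centering means `μ_k = k⁻¹ ∑_{j=1}^{k-1} α(k) Δf(j) 𝔼 S_{j,k}`. -/
def centeringMean {Ω : Type*} [MeasurableSpace Ω] (P : Measure Ω) (γ : ℝ) (f α : ℕ → ℝ)
    (E : ℕ → Ω → ℝ) (k : ℕ) : ℝ :=
  (k : ℝ)⁻¹ * ∑ j ∈ Finset.Ico 1 k, α k * incr f j * ∫ ω, expSum γ E j k ω ∂P

end

/-! The proof is a second-moment argument along the squares, combined with monotonicity between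
consecutive squares. Independence gives exact moments: the mean of `expSum` is a product `harmProd`,
and for i ≤ j the covariance of S_{i,k} and S_{j,k} is the mean of S_{i,j} times the variance of
S_{j,k}. That variance is at most a constant times (j/k)^{2γ}, and also O(1/j); the first bound is
used on the diagonal, the second off it (`integral_sq_sum_centered_expSum_le`).

For q² < k ≤ (q+1)² put n = q²+1. Since S_{j,k} = S_{j,n} S_{n,k}, and S and its mean are monotone
in the interval of summation, all centered sums of the block are controlled by one random variable
R_q = `blockBound`, free of k and α (`abs_SStar_le`). Its second moment is at most a constant times
w_q = `blockWeight` (`integral_blockBound_sq_le`), and the growth hypotheses say exactly that α(k)²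
w_q = O(q^{3-δ}) on the block (`exists_sq_mul_blockWeight_le`). As q⁴ ≤ k², the quantity α(k)² R_q²
/ k² is at most a constant times q^{-1-δ} R_q² / w_q, whose expectations are summable; hence it
tends to 0 almost surely. The finitely many indices j < L contribute O(α(k)/k), which vanishes by
`tendsto_sq_div_of_bound_sum_div`. -/

/-! ### The standard exponential law. -/

/-- The Laplace transform of the standard exponential distribution. -/
lemma integral_exp_neg_mul_expMeasure {t : ℝ} (ht : 0 ≤ t) :
    ∫ x, Real.exp (-t * x) ∂(expMeasure 1) = (1 + t)⁻¹ := by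
  have hd : expMeasure 1 = volume.withDensity (fun x => exponentialPDF 1 x) := rfl
  rw [hd, integral_withDensity_eq_integral_toReal_smul]
  · have h : ∀ x : ℝ, (exponentialPDF 1 x).toReal • Real.exp (-t * x)
        = Set.indicator (Set.Ici 0) (fun x => Real.exp (-(1 + t) * x)) x := by
      intro x
      rw [exponentialPDF_eq]
      by_cases hx : 0 ≤ x
      · rw [Set.indicator_of_mem (Set.mem_Ici.2 hx), if_pos hx,
          ENNReal.toReal_ofReal (by positivity), smul_eq_mul, one_mul, one_mul, ← Real.exp_add]
        congr 1
        ring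
      · rw [Set.indicator_of_notMem (by simpa using hx), if_neg hx]
        simp
    simp_rw [h]
    rw [integral_indicator measurableSet_Ici, integral_Ici_eq_integral_Ioi,
      integral_exp_mul_Ioi (by linarith)]
    rw [mul_zero, Real.exp_zero, neg_div_neg_eq, one_div]
  · exact (measurable_exponentialPDFReal 1).ennreal_ofReal
  · exact Eventually.of_forall fun x => ENNReal.ofReal_lt_top

lemma ae_nonneg_expMeasure : ∀ᵐ x ∂(expMeasure 1), 0 ≤ x := by
  have hd : expMeasure 1 = volume.withDensity (fun x => exponentialPDF 1 x) := rfl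
  have hm : Measurable (exponentialPDF 1) := (measurable_exponentialPDFReal 1).ennreal_ofReal
  rw [hd, ae_withDensity_iff hm]
  refine Eventually.of_forall fun x hx => ?_
  by_contra h
  exact hx (exponentialPDF_of_neg (not_le.1 h))

/-! ### Pathwise properties and exact moments of `expSum`. -/

section Exponentials

variable {Ω : Type*} {E : ℕ → Ω → ℝ} {γ : ℝ}

lemma expSum_pos (j k : ℕ) (ω : Ω) : 0 < expSum γ E j k ω := Real.exp_pos _

lemma expSum_mul_expSum {i j k : ℕ} (hij : i ≤ j) (hjk : j ≤ k) (ω : Ω) :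
    expSum γ E i j ω * expSum γ E j k ω = expSum γ E i k ω := by
  rw [expSum, expSum, expSum, ← Real.exp_add, ← mul_add, Finset.sum_Ico_consecutive _ hij hjk]

lemma expSum_le_one (hγ : 0 ≤ γ) {ω : Ω} (hω : ∀ h : ℕ, 1 ≤ h → 0 ≤ E h ω) {j : ℕ} (k : ℕ)
    (hj : 1 ≤ j) : expSum γ E j k ω ≤ 1 := by
  rw [expSum, Real.exp_le_one_iff, neg_mul, neg_nonpos]
  refine mul_nonneg hγ (Finset.sum_nonneg fun h hh => ?_)
  exact div_nonneg (hω h (hj.trans (Finset.mem_Ico.1 hh).1)) (Nat.cast_nonneg _)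

lemma expSum_antitone_interval (hγ : 0 ≤ γ) {ω : Ω} (hω : ∀ h : ℕ, 1 ≤ h → 0 ≤ E h ω)
    {n j k m : ℕ} (hn : 1 ≤ n) (hnj : n ≤ j) (hkm : k ≤ m) :
    expSum γ E n m ω ≤ expSum γ E j k ω := by
  rw [expSum, expSum, Real.exp_le_exp, neg_mul, neg_mul, neg_le_neg_iff]
  refine mul_le_mul_of_nonneg_left ?_ hγ
  refine Finset.sum_le_sum_of_subset_of_nonneg (Finset.Ico_subset_Ico hnj hkm) fun h hh _ => ?_
  exact div_nonneg (hω h (hn.trans (Finset.mem_Ico.1 hh).1)) (Nat.cast_nonneg _)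

variable [MeasurableSpace Ω] {P : Measure Ω}

lemma ae_nonneg_of_hasLaw_exp (hE : ∀ h : ℕ, HasLaw (E (h + 1)) (expMeasure 1) P) :
    ∀ᵐ ω ∂P, ∀ h : ℕ, 1 ≤ h → 0 ≤ E h ω := by
  have h1 : ∀ᵐ ω ∂P, ∀ h : ℕ, 0 ≤ E (h + 1) ω := by
    rw [ae_all_iff]
    intro h
    exact ((hE h).ae_iff (measurableSet_setOfPred.1 measurableSet_Ici)).2 ae_nonneg_expMeasure
  filter_upwards [h1] with ω hω h hh
  obtain ⟨l, rfl⟩ := Nat.exists_eq_add_of_le' hh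
  exact hω l

lemma aemeasurable_of_hasLaw_exp (hE : ∀ h : ℕ, HasLaw (E (h + 1)) (expMeasure 1) P) {h : ℕ}
    (hh : 1 ≤ h) : AEMeasurable (E h) P := by
  obtain ⟨l, rfl⟩ := Nat.exists_eq_add_of_le' hh
  exact (hE l).aemeasurable

lemma aemeasurable_expSum (hE : ∀ h : ℕ, HasLaw (E (h + 1)) (expMeasure 1) P) {j : ℕ} (k : ℕ)
    (hj : 1 ≤ j) : AEMeasurable (expSum γ E j k) P := by
  unfold expSum
  refine (AEMeasurable.const_mul ?_ _).exp
  refine Finset.aemeasurable_fun_sum _ fun h hh => ?_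
  exact (aemeasurable_of_hasLaw_exp hE (hj.trans (Finset.mem_Ico.1 hh).1)).div_const _

/-- The joint Laplace transform of independent standard exponential variables. -/
lemma integral_exp_neg_sum (hind : iIndepFun (fun h : ℕ => E (h + 1)) P)
    (hE : ∀ h : ℕ, HasLaw (E (h + 1)) (expMeasure 1) P) {c : ℕ → ℝ} (hc : ∀ h, 0 ≤ c h)
    {j k : ℕ} (hj : 1 ≤ j) :
    ∫ ω, Real.exp (-∑ h ∈ Finset.Ico j k, c h * E h ω) ∂P
      = ∏ h ∈ Finset.Ico j k, (1 + c h)⁻¹ := by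
  obtain ⟨l, rfl⟩ := Nat.exists_eq_add_of_le' hj
  have hind' : iIndepFun (fun (h : ℕ) ω => -c (h + 1) * E (h + 1) ω) P :=
    hind.comp (fun h x => -c (h + 1) * x) (fun h => by fun_prop)
  have hm : ∀ h : ℕ, AEMeasurable (fun ω => -c (h + 1) * E (h + 1) ω) P := fun h =>
    (hE h).aemeasurable.const_mul _
  have key := hind'.mgf_sum₀ (t := 1) hm (Finset.Ico l (k - 1))
  -- Nothing is known about `E 0`, so independence is indexed by h ↦ h + 1 and the sums are shifted
  -- accordingly.
  have hsum : ∀ F : ℕ → ℝ, ∑ h ∈ Finset.Ico (l + 1) k, F h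
      = ∑ h ∈ Finset.Ico l (k - 1), F (h + 1) := by
    intro F
    rcases Nat.eq_zero_or_pos k with rfl | hk
    · simp
    · obtain ⟨m, rfl⟩ := Nat.exists_eq_add_of_le' hk
      rw [Nat.add_sub_cancel, Finset.sum_Ico_add' F l m 1]
  have hprod : ∏ h ∈ Finset.Ico (l + 1) k, (1 + c h)⁻¹
      = ∏ h ∈ Finset.Ico l (k - 1), (1 + c (h + 1))⁻¹ := by
    rcases Nat.eq_zero_or_pos k with rfl | hk
    · simp
    · obtain ⟨m, rfl⟩ := Nat.exists_eq_add_of_le' hk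
      rw [Nat.add_sub_cancel, Finset.prod_Ico_add' (fun h => (1 + c h)⁻¹) l m 1]
  rw [hprod]
  have hL : ∫ ω, Real.exp (-∑ h ∈ Finset.Ico (l + 1) k, c h * E h ω) ∂P
      = mgf (∑ h ∈ Finset.Ico l (k - 1), fun ω => -c (h + 1) * E (h + 1) ω) P 1 := by
    rw [mgf]
    congr 1
    ext ω
    beta_reduce
    rw [hsum, Finset.sum_apply, one_mul, ← Finset.sum_neg_distrib]
    simp only [neg_mul]
  rw [hL, key]
  refine Finset.prod_congr rfl fun h _ => ?_
  rw [mgf, ← integral_exp_neg_mul_expMeasure (hc (h + 1))]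
  simp only [one_mul]
  exact (hE h).integral_comp (f := fun x => Real.exp (-c (h + 1) * x))
    (by fun_prop)

lemma integrable_expSum [IsFiniteMeasure P] (hγ : 0 ≤ γ) (hE : ∀ h : ℕ, HasLaw (E (h + 1)) (expMeasure 1) P) {j : ℕ}
    (k : ℕ) (hj : 1 ≤ j) : Integrable (expSum γ E j k) P := by
  refine Integrable.of_bound (aemeasurable_expSum hE k hj).aestronglyMeasurable 1 ?_
  filter_upwards [ae_nonneg_of_hasLaw_exp hE] with ω hω
  rw [Real.norm_of_nonneg (expSum_pos _ _ _).le]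
  exact expSum_le_one hγ hω k hj

lemma integrable_expSum_mul [IsFiniteMeasure P] (hγ : 0 ≤ γ) (hE : ∀ h : ℕ, HasLaw (E (h + 1)) (expMeasure 1) P)
    {i j : ℕ} (k l : ℕ) (hi : 1 ≤ i) (hj : 1 ≤ j) :
    Integrable (fun ω => expSum γ E i k ω * expSum γ E j l ω) P := by
  refine Integrable.of_bound ((aemeasurable_expSum hE k hi).mul
    (aemeasurable_expSum hE l hj)).aestronglyMeasurable 1 ?_
  filter_upwards [ae_nonneg_of_hasLaw_exp hE] with ω hω
  rw [Real.norm_of_nonneg (mul_pos (expSum_pos _ _ _) (expSum_pos _ _ _)).le]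
  exact mul_le_one₀ (expSum_le_one hγ hω k hi) (expSum_pos _ _ _).le (expSum_le_one hγ hω l hj)

/-- The product `∏_{h=j}^{k-1} (1 + γ/h)⁻¹`, the mean of `S_{j,k}`. -/
noncomputable def harmProd (γ : ℝ) (j k : ℕ) : ℝ := ∏ h ∈ Finset.Ico j k, (1 + γ / h)⁻¹

lemma integral_expSum (hγ : 0 ≤ γ) (hind : iIndepFun (fun h : ℕ => E (h + 1)) P)
    (hE : ∀ h : ℕ, HasLaw (E (h + 1)) (expMeasure 1) P) {j : ℕ} (k : ℕ) (hj : 1 ≤ j) :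
    ∫ ω, expSum γ E j k ω ∂P = harmProd γ j k := by
  rw [harmProd, ← integral_exp_neg_sum hind hE (fun h => by positivity) hj]
  congr 1
  ext ω
  rw [expSum, neg_mul, Finset.mul_sum]
  congr 2
  exact Finset.sum_congr rfl fun h _ => by ring

/-- In the exponent of the product, E_h carries γ/h for h < j and 2γ/h for h ≥ j, so the joint
Laplace transform splits at j. -/
lemma integral_expSum_mul_expSum (hγ : 0 ≤ γ) (hind : iIndepFun (fun h : ℕ => E (h + 1)) P)
    (hE : ∀ h : ℕ, HasLaw (E (h + 1)) (expMeasure 1) P) {i j k : ℕ} (hi : 1 ≤ i) (hij : i ≤ j)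
    (hjk : j ≤ k) :
    ∫ ω, expSum γ E i k ω * expSum γ E j k ω ∂P = harmProd γ i j * harmProd (2 * γ) j k := by
  have hp : harmProd γ i j * harmProd (2 * γ) j k
      = ∏ h ∈ Finset.Ico i k, (1 + (if h < j then γ / h else 2 * γ / h))⁻¹ := by
    rw [← Finset.prod_Ico_consecutive _ hij hjk, harmProd, harmProd]
    congr 1
    · exact Finset.prod_congr rfl fun h hh => by rw [if_pos (Finset.mem_Ico.1 hh).2]
    · exact Finset.prod_congr rfl fun h hh => by rw [if_neg (not_lt.2 (Finset.mem_Ico.1 hh).1)]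
  rw [hp, ← integral_exp_neg_sum hind hE (fun h => by split_ifs <;> positivity) hi]
  congr 1
  ext ω
  rw [expSum, expSum, ← Real.exp_add, ← Finset.sum_Ico_consecutive _ hij hjk,
    ← Finset.sum_Ico_consecutive _ hij hjk]
  have h1 : ∑ h ∈ Finset.Ico i j, (if h < j then γ / h else 2 * γ / h) * E h ω
      = γ * ∑ h ∈ Finset.Ico i j, E h ω / (h : ℝ) := by
    rw [Finset.mul_sum]
    exact Finset.sum_congr rfl fun h hh => by rw [if_pos (Finset.mem_Ico.1 hh).2]; ring
  have h2 : ∑ h ∈ Finset.Ico j k, (if h < j then γ / h else 2 * γ / h) * E h ω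
      = 2 * γ * ∑ h ∈ Finset.Ico j k, E h ω / (h : ℝ) := by
    rw [Finset.mul_sum]
    exact Finset.sum_congr rfl fun h hh => by
      rw [if_neg (not_lt.2 (Finset.mem_Ico.1 hh).1)]; ring
  rw [h1, h2]
  congr 1
  ring

end Exponentials

/-! ### Deterministic estimates for `harmProd`. -/

lemma sum_Ico_inv_sq_le {j : ℕ} (hj : 1 ≤ j) (n : ℕ) :
    ∑ h ∈ Finset.Ico j n, ((h : ℝ) ^ 2)⁻¹ ≤ 2 / j := by
  obtain ⟨l, rfl⟩ := Nat.exists_eq_add_of_le' hj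
  have h := sum_Ioo_inv_sq_le (α := ℝ) l n
  rw [← Finset.Ico_add_one_left_eq_Ioo] at h
  exact_mod_cast h

lemma sq_sum_Ico (y : ℕ → ℝ) (L n : ℕ) :
    (∑ j ∈ Finset.Ico L n, y j) ^ 2 = ∑ j ∈ Finset.Ico L n, y j ^ 2
      + 2 * ∑ j ∈ Finset.Ico L n, (∑ i ∈ Finset.Ico L j, y i) * y j := by
  rcases le_total n L with h | h
  · simp [h]
  · induction n, h using Nat.le_induction with
    | base => simp
    | succ n hn ih =>
      rw [Finset.sum_Ico_succ_top hn, Finset.sum_Ico_succ_top hn, Finset.sum_Ico_succ_top hn,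
        add_sq, ih]
      ring

/-- The value j = 0 is harmless: γ/0 = 0 makes that factor 1. -/
lemma harmProd_pos {γ : ℝ} (hγ : 0 ≤ γ) (j k : ℕ) : 0 < harmProd γ j k :=
  Finset.prod_pos fun h _ => by positivity

lemma harmProd_le_one {γ : ℝ} (hγ : 0 ≤ γ) (j k : ℕ) : harmProd γ j k ≤ 1 :=
  Finset.prod_le_one (fun h _ => by positivity) fun h _ => by
    apply inv_le_one_of_one_le₀
    have : 0 ≤ γ / (h : ℝ) := by positivity
    linarith

lemma harmProd_mul_harmProd (γ : ℝ) {i j k : ℕ} (hij : i ≤ j) (hjk : j ≤ k) :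
    harmProd γ i j * harmProd γ j k = harmProd γ i k :=
  Finset.prod_Ico_consecutive _ hij hjk

/-- Follows from log(1+x) ≥ 2x/(x+2) ≥ x - x². -/
lemma inv_one_add_le_exp {x : ℝ} (hx : 0 ≤ x) : (1 + x)⁻¹ ≤ Real.exp (x ^ 2) * Real.exp (-x) := by
  rw [← Real.exp_add, ← Real.log_le_iff_le_exp (by positivity), Real.log_inv]
  have h := Real.le_log_one_add_of_nonneg hx
  have h2 : x - x ^ 2 ≤ 2 * x / (x + 2) := by
    rw [le_div_iff₀ (by positivity)]
    nlinarith [mul_nonneg hx (sq_nonneg x), sq_nonneg x]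
  linarith

lemma exp_neg_div_le_rpow {c : ℝ} (hc : 0 ≤ c) {h : ℕ} (hh : 1 ≤ h) :
    Real.exp (-(c / h)) ≤ ((h : ℝ) / (h + 1 : ℕ)) ^ c := by
  have hh' : (0 : ℝ) < h := by exact_mod_cast hh
  rw [Real.rpow_def_of_pos (by positivity), Real.exp_le_exp]
  have h1 : Real.log (((h + 1 : ℕ) : ℝ) / h) ≤ 1 / h := by
    refine (Real.log_le_sub_one_of_pos (by positivity)).trans (le_of_eq ?_)
    push_cast
    field_simp
    ring
  have h2 : Real.log ((h : ℝ) / (h + 1 : ℕ)) = -Real.log (((h + 1 : ℕ) : ℝ) / h) := by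
    rw [← Real.log_inv, inv_div]
  rw [h2]
  have h3 := mul_le_mul_of_nonneg_right h1 hc
  have h4 : 1 / (h : ℝ) * c = c / h := by ring
  linarith

/-- Each factor is at most exp(c²/h²) (h/(h+1))^c. The powers telescope to (j/n)^c, and ∑ 1/h² ≤ 2/j
≤ 2 bounds the rest. The induction keeps the exact sum in the exponent, since the final constant
would not survive a step. -/
lemma harmProd_le_rpow {c : ℝ} (hc : 0 ≤ c) {j n : ℕ} (hj : 1 ≤ j) (hjn : j ≤ n) :
    harmProd c j n ≤ Real.exp (2 * c ^ 2) * ((j : ℝ) / n) ^ c := by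
  have key : harmProd c j n
      ≤ Real.exp (c ^ 2 * ∑ h ∈ Finset.Ico j n, ((h : ℝ) ^ 2)⁻¹) * ((j : ℝ) / n) ^ c := by
    induction n, hjn using Nat.le_induction with
    | base =>
      have : (j : ℝ) ≠ 0 := by positivity
      simp [harmProd, div_self this]
    | succ n hn ih =>
      have hn1 : 1 ≤ n := hj.trans hn
      have hn' : (0 : ℝ) < n := by exact_mod_cast hn1
      have hstep := (inv_one_add_le_exp (x := c / n) (by positivity)).trans
        (mul_le_mul_of_nonneg_left (exp_neg_div_le_rpow hc hn1) (Real.exp_pos _).le)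
      have hsplit : ((j : ℝ) / (n + 1 : ℕ)) ^ c
          = ((j : ℝ) / n) ^ c * ((n : ℝ) / (n + 1 : ℕ)) ^ c := by
        rw [← Real.mul_rpow (by positivity) (by positivity)]
        congr 1
        field_simp
      rw [harmProd, Finset.prod_Ico_succ_top hn, Finset.sum_Ico_succ_top hn, mul_add, Real.exp_add,
        hsplit]
      refine (mul_le_mul ih hstep (by positivity) (by positivity)).trans (le_of_eq ?_)
      rw [div_pow, div_eq_mul_inv (c ^ 2)]
      ring
  refine key.trans (mul_le_mul_of_nonneg_right ?_ (by positivity))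
  rw [Real.exp_le_exp, mul_comm 2]
  refine mul_le_mul_of_nonneg_left ((sum_Ico_inv_sq_le hj n).trans ?_) (sq_nonneg c)
  exact div_le_self (by norm_num) (by exact_mod_cast hj)

/-- The variance of `S_{j,n}` is `O(1/j)`. -/
lemma harmProd_two_mul_sub_sq_le {γ : ℝ} (hγ : 0 ≤ γ) {j : ℕ} (n : ℕ) (hj : 1 ≤ j) :
    harmProd (2 * γ) j n - harmProd γ j n ^ 2 ≤ 2 * γ ^ 2 * Real.exp (2 * γ ^ 2) / j := by
  set y := γ ^ 2 * ∑ h ∈ Finset.Ico j n, ((h : ℝ) ^ 2)⁻¹ with hy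
  have hj' : (1 : ℝ) ≤ j := by exact_mod_cast hj
  have hy0 : 0 ≤ y := by positivity
  have hyj : y ≤ 2 * γ ^ 2 / j := by
    have := mul_le_mul_of_nonneg_left (sum_Ico_inv_sq_le hj n) (sq_nonneg γ)
    rw [hy]
    refine this.trans (le_of_eq (by ring))
  have hy2 : y ≤ 2 * γ ^ 2 := hyj.trans (div_le_self (by positivity) hj')
  -- Factor by factor, with x = γ/h: (1+x)² ≤ (1+2x)(1+x²) ≤ (1+2x) exp(x²). The variance is then at
  -- most exp(y) - 1 ≤ y exp(y), and y = O(1/j).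
  have h1 : harmProd (2 * γ) j n ≤ harmProd γ j n ^ 2 * Real.exp y := by
    rw [hy, Finset.mul_sum, Real.exp_sum, harmProd, harmProd, ← Finset.prod_pow,
      ← Finset.prod_mul_distrib]
    refine Finset.prod_le_prod (fun h _ => by positivity) fun h _ => ?_
    set x := γ / (h : ℝ) with hx
    have hx0 : 0 ≤ x := by positivity
    have e1 : 2 * γ / (h : ℝ) = 2 * x := by rw [hx]; ring
    have e2 : γ ^ 2 * ((h : ℝ) ^ 2)⁻¹ = x ^ 2 := by rw [hx, div_pow]; rfl
    rw [e1, e2, inv_pow, inv_mul_eq_div, le_div_iff₀ (by positivity), inv_mul_eq_div,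
      div_le_iff₀ (by positivity)]
    have := mul_le_mul_of_nonneg_right (Real.add_one_le_exp (x ^ 2))
      (by positivity : 0 ≤ 1 + 2 * x)
    nlinarith [mul_nonneg hx0 (sq_nonneg x)]
  have h2 : harmProd γ j n ^ 2 ≤ 1 := pow_le_one₀ (harmProd_pos hγ _ _).le (harmProd_le_one hγ _ _)
  have h3 : Real.exp y - 1 ≤ y * Real.exp y := by
    have := mul_le_mul_of_nonneg_right (Real.one_sub_le_exp_neg y) (Real.exp_pos y).le
    rw [← Real.exp_add, neg_add_cancel, Real.exp_zero] at this
    linarith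
  have h4 : y * Real.exp y ≤ 2 * γ ^ 2 / j * Real.exp (2 * γ ^ 2) :=
    mul_le_mul hyj (Real.exp_le_exp.2 hy2) (Real.exp_pos _).le (by positivity)
  have h5 : 0 ≤ Real.exp y - 1 := by linarith [Real.add_one_le_exp y]
  calc harmProd (2 * γ) j n - harmProd γ j n ^ 2
      ≤ harmProd γ j n ^ 2 * (Real.exp y - 1) := by linarith
    _ ≤ 1 * (Real.exp y - 1) := mul_le_mul_of_nonneg_right h2 h5
    _ ≤ 2 * γ ^ 2 / j * Real.exp (2 * γ ^ 2) := by linarith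
    _ = _ := by ring

lemma one_sub_harmProd_le {γ : ℝ} (hγ : 0 ≤ γ) {j n : ℕ} (hjn : j ≤ n) :
    1 - harmProd γ j n ≤ ∑ h ∈ Finset.Ico j n, γ / (h : ℝ) := by
  induction n, hjn using Nat.le_induction with
  | base => simp [harmProd]
  | succ n hn ih =>
    rw [Finset.sum_Ico_succ_top hn, harmProd, Finset.prod_Ico_succ_top hn]
    have hx : 0 ≤ γ / (n : ℝ) := by positivity
    set x := γ / (n : ℝ)
    have h1 : 1 - x ≤ (1 + x)⁻¹ := by
      rw [← one_div, le_div_iff₀ (by positivity)]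
      nlinarith [sq_nonneg x]
    have h2 := harmProd_le_one hγ j n
    have h3 := (harmProd_pos hγ j n).le
    rw [harmProd] at h2 h3 ih
    nlinarith [mul_le_mul_of_nonneg_left h1 h3]

/-! ### Covariances and second moments of centered sums. -/

section Moments

variable {Ω : Type*} [MeasurableSpace Ω] {P : Measure Ω} [IsProbabilityMeasure P] {E : ℕ → Ω → ℝ}
  {γ : ℝ}

/-- S_{i,k} = S_{i,j} S_{j,k} with independent factors, so only the variance of S_{j,k} remains,
damped by the mean of S_{i,j}. -/
lemma integral_centered_expSum_mul (hγ : 0 ≤ γ) (hind : iIndepFun (fun h : ℕ => E (h + 1)) P)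
    (hE : ∀ h : ℕ, HasLaw (E (h + 1)) (expMeasure 1) P) {i j k : ℕ} (hi : 1 ≤ i) (hij : i ≤ j)
    (hjk : j ≤ k) :
    ∫ ω, (expSum γ E i k ω - harmProd γ i k) * (expSum γ E j k ω - harmProd γ j k) ∂P
      = harmProd γ i j * (harmProd (2 * γ) j k - harmProd γ j k ^ 2) := by
  have hj := hi.trans hij
  have e : ∀ ω, (expSum γ E i k ω - harmProd γ i k) * (expSum γ E j k ω - harmProd γ j k)
      = expSum γ E i k ω * expSum γ E j k ω - harmProd γ j k * expSum γ E i k ω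
        - (harmProd γ i k * expSum γ E j k ω - harmProd γ i k * harmProd γ j k) := fun ω => by ring
  have i1 := integrable_expSum_mul hγ hE k k hi hj
  have i2 := (integrable_expSum hγ hE k hi).const_mul (harmProd γ j k)
  have i3 := (integrable_expSum hγ hE k hj).const_mul (harmProd γ i k)
  have i12 : Integrable (fun ω => expSum γ E i k ω * expSum γ E j k ω
    - harmProd γ j k * expSum γ E i k ω) P := i1.sub i2
  have i3c : Integrable (fun ω => harmProd γ i k * expSum γ E j k ω
    - harmProd γ i k * harmProd γ j k) P := i3.sub (integrable_const _)
  simp_rw [e]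
  rw [integral_sub i12 i3c, integral_sub i1 i2,
    integral_sub i3 (integrable_const _), integral_const_mul, integral_const_mul,
    integral_expSum hγ hind hE k hi, integral_expSum hγ hind hE k hj,
    integral_expSum_mul_expSum hγ hind hE hi hij hjk, ← harmProd_mul_harmProd γ hij hjk]
  simp
  ring

lemma integrable_centered_expSum_mul (hγ : 0 ≤ γ)
    (hE : ∀ h : ℕ, HasLaw (E (h + 1)) (expMeasure 1) P) {i j : ℕ} (k : ℕ) (hi : 1 ≤ i)
    (hj : 1 ≤ j) (a b : ℝ) :
    Integrable (fun ω => (expSum γ E i k ω - a) * (expSum γ E j k ω - b)) P := by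
  have e : ∀ ω, (expSum γ E i k ω - a) * (expSum γ E j k ω - b)
      = expSum γ E i k ω * expSum γ E j k ω - b * expSum γ E i k ω
        - (a * expSum γ E j k ω - a * b) := fun ω => by ring
  simp_rw [e]
  exact ((integrable_expSum_mul hγ hE k k hi hj).sub
    ((integrable_expSum hγ hE k hi).const_mul b)).sub
    (((integrable_expSum hγ hE k hj).const_mul a).sub (integrable_const _))

/-- `E (∑ aⱼ (S_{j,n} - E S_{j,n}))² = O(∑ aⱼ² (j/n)^{2γ} + ∑_{i<j} aᵢ aⱼ / j)`. -/
lemma integral_sq_sum_centered_expSum_le (hγ : 0 ≤ γ)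
    (hind : iIndepFun (fun h : ℕ => E (h + 1)) P)
    (hE : ∀ h : ℕ, HasLaw (E (h + 1)) (expMeasure 1) P) {a : ℕ → ℝ} (ha : ∀ j, 1 ≤ j → 0 ≤ a j)
    {L : ℕ} (n : ℕ) (hL : 1 ≤ L) :
    Integrable (fun ω => (∑ j ∈ Finset.Ico L n, a j * (expSum γ E j n ω - harmProd γ j n)) ^ 2) P ∧
    ∫ ω, (∑ j ∈ Finset.Ico L n, a j * (expSum γ E j n ω - harmProd γ j n)) ^ 2 ∂P
      ≤ Real.exp (8 * γ ^ 2) * ∑ j ∈ Finset.Ico L n, a j ^ 2 * ((j : ℝ) / n) ^ (2 * γ)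
        + 4 * γ ^ 2 * Real.exp (2 * γ ^ 2)
          * ∑ j ∈ Finset.Ico L n, (∑ i ∈ Finset.Ico L j, a i) * a j * (1 / (j : ℝ)) := by
  have e : ∀ ω, (∑ j ∈ Finset.Ico L n, a j * (expSum γ E j n ω - harmProd γ j n)) ^ 2
      = ∑ j ∈ Finset.Ico L n, a j ^ 2 * ((expSum γ E j n ω - harmProd γ j n)
            * (expSum γ E j n ω - harmProd γ j n))
        + ∑ j ∈ Finset.Ico L n, ∑ i ∈ Finset.Ico L j, 2 * a i * a j
            * ((expSum γ E i n ω - harmProd γ i n) * (expSum γ E j n ω - harmProd γ j n)) := by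
    intro ω
    rw [sq_sum_Ico, Finset.mul_sum]
    congr 1
    · exact Finset.sum_congr rfl fun j _ => by ring
    · refine Finset.sum_congr rfl fun j _ => ?_
      rw [Finset.sum_mul, Finset.mul_sum]
      exact Finset.sum_congr rfl fun i _ => by ring
  have hint : ∀ i j : ℕ, L ≤ i → L ≤ j → Integrable (fun ω =>
      (expSum γ E i n ω - harmProd γ i n) * (expSum γ E j n ω - harmProd γ j n)) P :=
    fun i j hi hj => integrable_centered_expSum_mul hγ hE n (hL.trans hi) (hL.trans hj) _ _
  have hI1 : ∀ j ∈ Finset.Ico L n, Integrable (fun ω => a j ^ 2 *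
      ((expSum γ E j n ω - harmProd γ j n) * (expSum γ E j n ω - harmProd γ j n))) P :=
    fun j hj => (hint j j (Finset.mem_Ico.1 hj).1 (Finset.mem_Ico.1 hj).1).const_mul _
  have hI2 : ∀ j ∈ Finset.Ico L n, ∀ i ∈ Finset.Ico L j, Integrable (fun ω => 2 * a i * a j *
      ((expSum γ E i n ω - harmProd γ i n) * (expSum γ E j n ω - harmProd γ j n))) P :=
    fun j hj i hi => (hint i j (Finset.mem_Ico.1 hi).1 (Finset.mem_Ico.1 hj).1).const_mul _
  have hI3 := fun j hj => integrable_finsetSum _ (hI2 j hj)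
  simp_rw [e]
  refine ⟨(integrable_finsetSum _ hI1).add (integrable_finsetSum _ hI3), ?_⟩
  rw [integral_add (integrable_finsetSum _ hI1) (integrable_finsetSum _ hI3),
    integral_finsetSum _ hI1, integral_finsetSum _ hI3, Finset.mul_sum, Finset.mul_sum]
  refine add_le_add (Finset.sum_le_sum fun j hj => ?_) (Finset.sum_le_sum fun j hj => ?_)
  · obtain ⟨hj1, hj2⟩ := Finset.mem_Ico.1 hj
    rw [integral_const_mul, integral_centered_expSum_mul hγ hind hE (hL.trans hj1) le_rfl hj2.le]
    have h1 : harmProd γ j j = 1 := by simp [harmProd]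
    -- On the diagonal the variance is bounded by the second moment, which retains the decay
    -- (j/n)^{2γ}.
    have h2 := harmProd_le_rpow (c := 2 * γ) (by positivity) (hL.trans hj1) hj2.le
    have h3 : 2 * (2 * γ) ^ 2 = 8 * γ ^ 2 := by ring
    rw [h3] at h2
    rw [h1, one_mul, mul_left_comm]
    exact mul_le_mul_of_nonneg_left (by linarith [sq_nonneg (harmProd γ j n)]) (sq_nonneg _)
  · obtain ⟨hj1, hj2⟩ := Finset.mem_Ico.1 hj
    rw [integral_finsetSum _ (hI2 j hj), Finset.sum_mul, Finset.sum_mul, Finset.mul_sum]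
    refine Finset.sum_le_sum fun i hi => ?_
    obtain ⟨hi1, hi2⟩ := Finset.mem_Ico.1 hi
    rw [integral_const_mul, integral_centered_expSum_mul hγ hind hE (hL.trans hi1) hi2.le hj2.le]
    have hai := ha i (hL.trans hi1)
    have haj := ha j (hL.trans hj1)
    have h1 : harmProd γ i j * (harmProd (2 * γ) j n - harmProd γ j n ^ 2)
        ≤ 2 * γ ^ 2 * Real.exp (2 * γ ^ 2) / j := by
      refine (mul_le_mul_of_nonneg_left (harmProd_two_mul_sub_sq_le hγ n (hL.trans hj1))
        (harmProd_pos hγ i j).le).trans ?_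
      exact mul_le_of_le_one_left (by positivity) (harmProd_le_one hγ i j)
    refine (mul_le_mul_of_nonneg_left h1 (by positivity)).trans (le_of_eq (by ring))

/-- `E (1 - S_{n,m})² = O((1/n) + (∑ γ/h)²)`. -/
lemma integral_sq_one_sub_expSum_le (hγ : 0 ≤ γ) (hind : iIndepFun (fun h : ℕ => E (h + 1)) P)
    (hE : ∀ h : ℕ, HasLaw (E (h + 1)) (expMeasure 1) P) {n m : ℕ} (hn : 1 ≤ n) (hnm : n ≤ m) :
    ∫ ω, (1 - expSum γ E n m ω) ^ 2 ∂P
      ≤ 2 * γ ^ 2 * Real.exp (2 * γ ^ 2) / n + (∑ h ∈ Finset.Ico n m, γ / (h : ℝ)) ^ 2 := by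
  have e : ∀ ω, (1 - expSum γ E n m ω) ^ 2
      = 1 - 2 * expSum γ E n m ω + expSum γ E n m ω * expSum γ E n m ω := fun ω => by ring
  have i1 := integrable_expSum_mul hγ hE m m hn hn
  have i2 := (integrable_expSum hγ hE m hn).const_mul 2
  have ic2 : Integrable (fun ω => 1 - 2 * expSum γ E n m ω) P := (integrable_const _).sub i2
  simp_rw [e]
  rw [integral_add ic2 i1, integral_sub (integrable_const _) i2,
    integral_const_mul, integral_expSum hγ hind hE m hn,
    integral_expSum_mul_expSum hγ hind hE hn le_rfl hnm]
  have h1 : harmProd γ n n = 1 := by simp [harmProd]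
  have h2 := harmProd_two_mul_sub_sq_le hγ m hn
  have h3 := pow_le_pow_left₀ (by linarith [harmProd_le_one hγ n m]) (one_sub_harmProd_le hγ hnm) 2
  rw [h1]
  simp only [integral_const, probReal_univ, smul_eq_mul]
  linarith

end Moments

/-! ### Almost sure convergence from summable means, and the block quantities. -/

/-- By Tonelli the series of the `u q` has finite expectation, hence converges almost surely, and
its terms tend to 0. -/
lemma ae_tendsto_zero_of_summable_integral {Ω : Type*} [MeasurableSpace Ω] {P : Measure Ω}
    {u : ℕ → Ω → ℝ} {b : ℕ → ℝ} (hu0 : ∀ q ω, 0 ≤ u q ω) (hu : ∀ q, Integrable (u q) P)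
    (hub : ∀ q, ∫ ω, u q ω ∂P ≤ b q) (hb : Summable b) :
    ∀ᵐ ω ∂P, Tendsto (fun q => u q ω) atTop (𝓝 0) := by
  have hm : ∀ q, AEMeasurable (fun ω => ENNReal.ofReal (u q ω)) P := fun q =>
    (hu q).aemeasurable.ennreal_ofReal
  have hfin : ∫⁻ ω, ∑' q, ENNReal.ofReal (u q ω) ∂P ≠ ⊤ := by
    rw [lintegral_tsum hm]
    refine ne_top_of_le_ne_top hb.tsum_ofReal_ne_top (ENNReal.tsum_le_tsum fun q => ?_)
    rw [← ofReal_integral_eq_lintegral_ofReal (hu q) (Eventually.of_forall (hu0 q))]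
    exact ENNReal.ofReal_le_ofReal (hub q)
  filter_upwards [ae_lt_top' (AEMeasurable.tsum hm) hfin] with ω hω
  have h := ENNReal.tendsto_atTop_zero_of_tsum_ne_top hω.ne
  have h2 := (ENNReal.tendsto_toReal ENNReal.zero_ne_top).comp h
  simpa [Function.comp_def, ENNReal.toReal_ofReal (hu0 _ ω)] using h2

lemma incr_pos {f : ℕ → ℝ} (hf : StrictMono f) {j : ℕ} (hj : 1 ≤ j) : 0 < incr f j :=
  sub_pos.2 (hf (by omega))

/-- The sum `∑_{L ≤ i < j < n} aᵢ aⱼ / j`. -/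
noncomputable def crossSum (a : ℕ → ℝ) (L n : ℕ) : ℝ :=
  ∑ j ∈ Finset.Ico L n, (∑ i ∈ Finset.Ico L j, a i) * a j * (1 / (j : ℝ))

/-- The diagonal sum `∑_{L ≤ j < n} aⱼ² (j/n)^{2γ}`. -/
noncomputable def diagSum (γ : ℝ) (a : ℕ → ℝ) (L n : ℕ) : ℝ :=
  ∑ j ∈ Finset.Ico L n, a j ^ 2 * ((j : ℝ) / n) ^ (2 * γ)

/-- The variance proxy for the block `q² < k ≤ (q+1)²`. -/
noncomputable def blockWeight (γ : ℝ) (a : ℕ → ℝ) (L q : ℕ) : ℝ :=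
  diagSum γ a L (q ^ 2 + 1) + crossSum a L (q ^ 2 + 1)
    + (∑ j ∈ Finset.Ico (q ^ 2 + 1) (q ^ 2 + 1 + (2 * q + 1)), a j ^ 2
      + crossSum a (q ^ 2 + 1) (q ^ 2 + 1 + (2 * q + 1)))

/-- A random bound for the centered sums, uniform over the block `q² < k ≤ (q+1)²`. -/
noncomputable def blockBound {Ω : Type*} (γ : ℝ) (a : ℕ → ℝ) (E : ℕ → Ω → ℝ) (L q : ℕ) (ω : Ω) :
    ℝ :=
  |∑ j ∈ Finset.Ico L (q ^ 2 + 1),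
      a j * (expSum γ E j (q ^ 2 + 1) ω - harmProd γ j (q ^ 2 + 1))|
    + (∑ j ∈ Finset.Ico L (q ^ 2 + 1), a j * harmProd γ j (q ^ 2 + 1)
      + ∑ j ∈ Finset.Ico (q ^ 2 + 1) (q ^ 2 + 1 + (2 * q + 1)), a j)
      * ((1 - expSum γ E (q ^ 2 + 1) ((q + 1) ^ 2) ω)
        + (1 - harmProd γ (q ^ 2 + 1) ((q + 1) ^ 2)))

/-! ### Comparison of block sums with `blockWeight`. -/

section Weights

variable {γ : ℝ} {a : ℕ → ℝ}

lemma crossSum_nonneg (ha : ∀ j, 1 ≤ j → 0 ≤ a j) {L : ℕ} (hL : 1 ≤ L) (n : ℕ) :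
    0 ≤ crossSum a L n :=
  Finset.sum_nonneg fun j hj => mul_nonneg (mul_nonneg
    (Finset.sum_nonneg fun i hi => ha i (hL.trans (Finset.mem_Ico.1 hi).1))
    (ha j (hL.trans (Finset.mem_Ico.1 hj).1))) (by positivity)

lemma diagSum_nonneg (L n : ℕ) : 0 ≤ diagSum γ a L n :=
  Finset.sum_nonneg fun j _ => by positivity

lemma blockWeight_pos (ha : ∀ j, 1 ≤ j → 0 < a j) {L : ℕ} (hL : 1 ≤ L) (q : ℕ) :
    0 < blockWeight γ a L q := by
  have h1 := crossSum_nonneg (fun j hj => (ha j hj).le) hL (q ^ 2 + 1)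
  have h2 := crossSum_nonneg (fun j hj => (ha j hj).le) (Nat.le_add_left 1 (q ^ 2))
    (q ^ 2 + 1 + (2 * q + 1))
  have h3 := diagSum_nonneg (γ := γ) (a := a) L (q ^ 2 + 1)
  have h4 : 0 < ∑ j ∈ Finset.Ico (q ^ 2 + 1) (q ^ 2 + 1 + (2 * q + 1)), a j ^ 2 :=
    Finset.sum_pos (fun j hj => pow_pos (ha j (by have := (Finset.mem_Ico.1 hj).1; omega)) 2)
      (Finset.nonempty_Ico.2 (by omega))
  rw [blockWeight]
  linarith

/-- Here j ≤ q², so off the diagonal the factor 1/q² is at most the weight 1/j of `crossSum`; on the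
diagonal `harmProd` squared supplies (j/n)^{2γ}. -/
lemma sq_sum_mul_harmProd_le (hγ : 0 ≤ γ) (ha : ∀ j, 1 ≤ j → 0 ≤ a j) {L q : ℕ} (hL : 1 ≤ L)
    (hq : 1 ≤ q) :
    (∑ j ∈ Finset.Ico L (q ^ 2 + 1), a j * harmProd γ j (q ^ 2 + 1)) ^ 2 / (q : ℝ) ^ 2
      ≤ Real.exp (4 * γ ^ 2) * diagSum γ a L (q ^ 2 + 1) + 2 * crossSum a L (q ^ 2 + 1) := by
  have hq' : (1 : ℝ) ≤ q := by exact_mod_cast hq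
  rw [sq_sum_Ico, add_div, mul_div_assoc, diagSum, crossSum, Finset.mul_sum]
  refine add_le_add ?_ (mul_le_mul_of_nonneg_left ?_ zero_le_two)
  · refine (div_le_self (Finset.sum_nonneg fun j _ => sq_nonneg _) (one_le_pow₀ hq')).trans ?_
    refine Finset.sum_le_sum fun j hj => ?_
    obtain ⟨hj1, hj2⟩ := Finset.mem_Ico.1 hj
    have h := pow_le_pow_left₀ (harmProd_pos hγ _ _).le
      (harmProd_le_rpow hγ (hL.trans hj1) hj2.le) 2
    have e : (Real.exp (2 * γ ^ 2) * ((j : ℝ) / (q ^ 2 + 1 : ℕ)) ^ γ) ^ 2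
        = Real.exp (4 * γ ^ 2) * ((j : ℝ) / (q ^ 2 + 1 : ℕ)) ^ (2 * γ) := by
      rw [mul_pow, ← Real.exp_nat_mul, ← Real.rpow_mul_natCast (by positivity)]
      congr 2
      · push_cast; ring
      · push_cast; ring
    rw [e] at h
    rw [mul_pow, mul_left_comm]
    exact mul_le_mul_of_nonneg_left h (sq_nonneg _)
  · rw [Finset.sum_div]
    refine Finset.sum_le_sum fun j hj => ?_
    obtain ⟨hj1, hj2⟩ := Finset.mem_Ico.1 hj
    have hj0 : (0 : ℝ) < j := by exact_mod_cast hL.trans hj1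
    have hjq : (j : ℝ) ≤ (q : ℝ) ^ 2 := by exact_mod_cast Nat.lt_succ_iff.1 hj2
    have haj := ha j (hL.trans hj1)
    have hai : ∀ i ∈ Finset.Ico L j, 0 ≤ a i := fun i hi =>
      ha i (hL.trans (Finset.mem_Ico.1 hi).1)
    have hs : 0 ≤ ∑ i ∈ Finset.Ico L j, a i := Finset.sum_nonneg hai
    rw [div_eq_mul_one_div]
    refine mul_le_mul ?_ (one_div_le_one_div_of_le hj0 hjq) (by positivity) (mul_nonneg hs haj)
    refine mul_le_mul (Finset.sum_le_sum fun i hi => ?_) ?_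
      (mul_nonneg haj (harmProd_pos hγ _ _).le) hs
    · exact mul_le_of_le_one_right (hai i hi) (harmProd_le_one hγ _ _)
    · exact mul_le_of_le_one_right haj (harmProd_le_one hγ _ _)

/-- Inside the block j ≤ (q+1)² ≤ 4q², so 1/q² ≤ 4/j; the 8 is this 4 times the 2 of the squared
sum. -/
lemma sq_sum_block_le (ha : ∀ j, 1 ≤ j → 0 ≤ a j) {q : ℕ} (hq : 1 ≤ q) :
    (∑ j ∈ Finset.Ico (q ^ 2 + 1) (q ^ 2 + 1 + (2 * q + 1)), a j) ^ 2 / (q : ℝ) ^ 2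
      ≤ ∑ j ∈ Finset.Ico (q ^ 2 + 1) (q ^ 2 + 1 + (2 * q + 1)), a j ^ 2
        + 8 * crossSum a (q ^ 2 + 1) (q ^ 2 + 1 + (2 * q + 1)) := by
  have hq' : (1 : ℝ) ≤ q := by exact_mod_cast hq
  rw [sq_sum_Ico, add_div, mul_div_assoc, crossSum]
  refine add_le_add ?_ ?_
  · exact div_le_self (Finset.sum_nonneg fun j _ => sq_nonneg _) (one_le_pow₀ hq')
  · rw [show (8 : ℝ) = 2 * 4 by norm_num, mul_assoc, Finset.sum_div, Finset.mul_sum _ _ (4 : ℝ)]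
    refine mul_le_mul_of_nonneg_left ?_ zero_le_two
    refine Finset.sum_le_sum fun j hj => ?_
    obtain ⟨hj1, hj2⟩ := Finset.mem_Ico.1 hj
    have hj0 : (0 : ℝ) < j := by exact_mod_cast (by omega : 0 < j)
    have hjq : (j : ℝ) ≤ ((q : ℝ) + 1) ^ 2 := by
      have : j ≤ (q + 1) ^ 2 := by nlinarith
      exact_mod_cast this
    have haj := ha j (by omega)
    have hai : ∀ i ∈ Finset.Ico (q ^ 2 + 1) j, 0 ≤ a i := fun i hi =>
      ha i (by have := (Finset.mem_Ico.1 hi).1; omega)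
    have h : 1 / (q : ℝ) ^ 2 ≤ 4 * (1 / j) := by
      rw [mul_one_div, div_le_div_iff₀ (by positivity) hj0]
      nlinarith
    rw [div_eq_mul_one_div, mul_left_comm 4]
    exact mul_le_mul_of_nonneg_left h (mul_nonneg (Finset.sum_nonneg hai) haj)

lemma sum_block_div_le (hγ : 0 ≤ γ) {q : ℕ} (hq : 1 ≤ q) :
    ∑ h ∈ Finset.Ico (q ^ 2 + 1 : ℕ) ((q + 1) ^ 2), γ / (h : ℝ) ≤ 2 * γ / q := by
  have hq' : (1 : ℝ) ≤ q := by exact_mod_cast hq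
  have h := Finset.sum_le_card_nsmul (Finset.Ico (q ^ 2 + 1) ((q + 1) ^ 2))
    (fun h : ℕ => γ / (h : ℝ)) (γ / (q : ℝ) ^ 2) (fun h hh => by
      have hh' : (q : ℝ) ^ 2 ≤ h := by
        exact_mod_cast (Nat.le_succ _).trans (Finset.mem_Ico.1 hh).1
      exact div_le_div_of_nonneg_left hγ (by positivity) hh')
  have hc : (q + 1) ^ 2 - (q ^ 2 + 1) = 2 * q := by
    rw [show (q + 1) ^ 2 = q ^ 2 + 1 + 2 * q by ring]; omega
  rw [Nat.card_Ico, hc, nsmul_eq_mul] at h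
  refine h.trans (le_of_eq ?_)
  push_cast
  field_simp

end Weights

/-! ### Second moment of the block bound. -/

section Block

variable {Ω : Type*} [MeasurableSpace Ω] {P : Measure Ω} [IsProbabilityMeasure P] {E : ℕ → Ω → ℝ}
  {γ : ℝ} {a : ℕ → ℝ}

/-- With `blockBound` = |T| + (M + F) V, the T term is a centered sum at the fixed time n, while V
has second moment O(1/q²), which is what normalizes M² and F². -/
lemma integral_blockBound_sq_le (hγ : 0 ≤ γ) (hind : iIndepFun (fun h : ℕ => E (h + 1)) P)
    (hE : ∀ h : ℕ, HasLaw (E (h + 1)) (expMeasure 1) P) (ha : ∀ j, 1 ≤ j → 0 ≤ a j)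
    {L : ℕ} (hL : 1 ≤ L) :
    ∃ K : ℝ, ∀ q : ℕ, 1 ≤ q → Integrable (fun ω => blockBound γ a E L q ω ^ 2) P ∧
      ∫ ω, blockBound γ a E L q ω ^ 2 ∂P ≤ K * blockWeight γ a L q := by
  set e2 := Real.exp (2 * γ ^ 2) with he2
  set e4 := Real.exp (4 * γ ^ 2) with he4
  set e8 := Real.exp (8 * γ ^ 2) with he8
  set B := 4 * γ ^ 2 * e2 + 16 * γ ^ 2 with hB
  -- The three summands come from T, M and F; B/q² bounds the mean of the majorant of V², and each 3
  -- comes from squaring a sum of three terms.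
  refine ⟨3 * (e8 + 4 * γ ^ 2 * e2) + 3 * B * (e4 + 2) + 3 * B * 8, fun q hq => ?_⟩
  have hq' : (1 : ℝ) ≤ q := by exact_mod_cast hq
  set n := q ^ 2 + 1 with hn
  set m := (q + 1) ^ 2 with hm
  have hn1 : 1 ≤ n := by omega
  have hnm : n ≤ m := by rw [hn, hm]; nlinarith
  obtain ⟨hTi, hT⟩ := integral_sq_sum_centered_expSum_le hγ hind hE ha n hL
  have hM := sq_sum_mul_harmProd_le hγ ha hL hq
  have hF := sq_sum_block_le ha hq
  have hW := integral_sq_one_sub_expSum_le hγ hind hE hn1 hnm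
  have hs := sum_block_div_le hγ hq
  have hw := one_sub_harmProd_le hγ hnm
  have hw0 : 0 ≤ 1 - harmProd γ n m := sub_nonneg.2 (harmProd_le_one hγ n m)
  rw [← hn] at hM hF
  rw [← hn, ← hm] at hs
  have hWi : Integrable (fun ω => (1 - expSum γ E n m ω) ^ 2) P := by
    have := integrable_centered_expSum_mul hγ hE m hn1 hn1 1 1
    refine this.congr (Eventually.of_forall fun ω => ?_)
    simp only
    ring
  set T : Ω → ℝ := fun ω => ∑ j ∈ Finset.Ico L n, a j * (expSum γ E j n ω - harmProd γ j n)
    with hTdef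
  set M := ∑ j ∈ Finset.Ico L n, a j * harmProd γ j n with hMdef
  set F := ∑ j ∈ Finset.Ico n (n + (2 * q + 1)), a j with hFdef
  set w := 1 - harmProd γ n m with hwdef
  set Q := ∑ j ∈ Finset.Ico n (n + (2 * q + 1)), a j ^ 2 with hQdef
  set V : Ω → ℝ := fun ω => (1 - expSum γ E n m ω) + w with hVdef
  have hVi : Integrable (fun ω => 2 * (1 - expSum γ E n m ω) ^ 2 + 2 * w ^ 2) P :=
    (hWi.const_mul 2).add (integrable_const _)
  have hR : ∀ ω, blockBound γ a E L q ω = |T ω| + (M + F) * V ω := fun ω => rfl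
  have hbound : ∀ ω, blockBound γ a E L q ω ^ 2 ≤ 3 * T ω ^ 2
      + 3 * (M ^ 2 + F ^ 2) * (2 * (1 - expSum γ E n m ω) ^ 2 + 2 * w ^ 2) := by
    intro ω
    rw [hR]
    have hV2 : V ω ^ 2 ≤ 2 * (1 - expSum γ E n m ω) ^ 2 + 2 * w ^ 2 := add_sq_le.trans (by linarith)
    have h3 : (|T ω| + (M + F) * V ω) ^ 2 ≤ 3 * T ω ^ 2 + 3 * (M ^ 2 + F ^ 2) * V ω ^ 2 := by
      rw [← sq_abs (T ω)]
      nlinarith [sq_nonneg (|T ω| - M * V ω), sq_nonneg (|T ω| - F * V ω),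
        sq_nonneg (M * V ω - F * V ω)]
    exact h3.trans (add_le_add_right (mul_le_mul_of_nonneg_left hV2 (by positivity)) _)
  have hrhs : Integrable (fun ω => 3 * T ω ^ 2
      + 3 * (M ^ 2 + F ^ 2) * (2 * (1 - expSum γ E n m ω) ^ 2 + 2 * w ^ 2)) P :=
    (hTi.const_mul 3).add (hVi.const_mul _)
  have hmeasR : AEMeasurable (fun ω => blockBound γ a E L q ω ^ 2) P := by
    simp_rw [hR]
    have hTm : AEMeasurable T P := Finset.aemeasurable_fun_sum _ fun j hj =>
      ((aemeasurable_expSum hE n (hL.trans (Finset.mem_Ico.1 hj).1)).sub_const _).const_mul _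
    have hVm : AEMeasurable V P := ((aemeasurable_expSum hE m hn1).const_sub _).add_const _
    exact ((measurable_norm.comp_aemeasurable hTm).add (hVm.const_mul _)).pow_const 2
  have hRi : Integrable (fun ω => blockBound γ a E L q ω ^ 2) P :=
    hrhs.mono' hmeasR.aestronglyMeasurable (Eventually.of_forall fun ω => by
      rw [Real.norm_of_nonneg (sq_nonneg _)]; exact hbound ω)
  refine ⟨hRi, (integral_mono hRi hrhs hbound).trans ?_⟩
  rw [integral_add (hTi.const_mul 3) (hVi.const_mul _), integral_const_mul, integral_const_mul,
    integral_add (hWi.const_mul 2) (integrable_const _), integral_const_mul]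
  simp only [integral_const, probReal_univ, one_smul]
  have hs0 : 0 ≤ ∑ h ∈ Finset.Ico n m, γ / (h : ℝ) := hw0.trans hw
  have hs2 : (∑ h ∈ Finset.Ico n m, γ / (h : ℝ)) ^ 2 ≤ 4 * γ ^ 2 / (q : ℝ) ^ 2 := by
    refine (pow_le_pow_left₀ hs0 hs 2).trans (le_of_eq ?_)
    rw [div_pow]; ring
  have hw2 : w ^ 2 ≤ 4 * γ ^ 2 / (q : ℝ) ^ 2 := (pow_le_pow_left₀ hw0 hw 2).trans hs2
  have hn2 : 2 * γ ^ 2 * e2 / (n : ℝ) ≤ 2 * γ ^ 2 * e2 / (q : ℝ) ^ 2 := by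
    refine div_le_div_of_nonneg_left (by positivity) (by positivity) ?_
    rw [hn]; push_cast; linarith
  have hVB : 2 * ∫ ω, (1 - expSum γ E n m ω) ^ 2 ∂P + 2 * w ^ 2 ≤ B / (q : ℝ) ^ 2 := by
    have : B / (q : ℝ) ^ 2 = 2 * (2 * γ ^ 2 * e2 / (q : ℝ) ^ 2) + 4 * (4 * γ ^ 2 / (q : ℝ) ^ 2) := by
      rw [hB]; ring
    rw [this]
    linarith
  have hB0 : 0 ≤ B := by positivity
  have hMF : 3 * (M ^ 2 + F ^ 2) * (B / (q : ℝ) ^ 2)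
      ≤ 3 * B * (e4 * diagSum γ a L n + 2 * crossSum a L n)
        + 3 * B * (Q + 8 * crossSum a n (n + (2 * q + 1))) := by
    have e : 3 * (M ^ 2 + F ^ 2) * (B / (q : ℝ) ^ 2)
        = 3 * B * (M ^ 2 / (q : ℝ) ^ 2) + 3 * B * (F ^ 2 / (q : ℝ) ^ 2) := by ring
    rw [e]
    exact add_le_add (mul_le_mul_of_nonneg_left hM (by positivity))
      (mul_le_mul_of_nonneg_left hF (by positivity))
  have hD := diagSum_nonneg (γ := γ) (a := a) L n
  have hC := crossSum_nonneg ha hL n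
  have hC' := crossSum_nonneg ha hn1 (n + (2 * q + 1))
  have hQ : 0 ≤ Q := Finset.sum_nonneg fun j _ => sq_nonneg _
  have hT' : ∫ ω, T ω ^ 2 ∂P ≤ e8 * diagSum γ a L n + 4 * γ ^ 2 * e2 * crossSum a L n := hT
  have hVB' := mul_le_mul_of_nonneg_left hVB (by positivity : 0 ≤ 3 * (M ^ 2 + F ^ 2))
  have hWt : blockWeight γ a L q
      = diagSum γ a L n + crossSum a L n + (Q + crossSum a n (n + (2 * q + 1))) := rfl
  set S := blockWeight γ a L q
  have hDS : diagSum γ a L n ≤ S := by linarith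
  have hCS : crossSum a L n ≤ S := by linarith
  have k1 : e8 * diagSum γ a L n + 4 * γ ^ 2 * e2 * crossSum a L n ≤ e8 * S + 4 * γ ^ 2 * e2 * S :=
    add_le_add (mul_le_mul_of_nonneg_left hDS (by positivity))
      (mul_le_mul_of_nonneg_left hCS (by positivity))
  have k2 : e4 * diagSum γ a L n + 2 * crossSum a L n ≤ e4 * S + 2 * S :=
    add_le_add (mul_le_mul_of_nonneg_left hDS (by positivity))
      (mul_le_mul_of_nonneg_left hCS zero_le_two)
  have k3 : Q + 8 * crossSum a n (n + (2 * q + 1)) ≤ 8 * S := by linarith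
  calc _ ≤ 3 * (e8 * S + 4 * γ ^ 2 * e2 * S) + (3 * B * (e4 * S + 2 * S) + 3 * B * (8 * S)) :=
        add_le_add (mul_le_mul_of_nonneg_left (hT'.trans k1) zero_le_three)
          ((hVB'.trans hMF).trans (add_le_add (mul_le_mul_of_nonneg_left k2 (by positivity))
            (mul_le_mul_of_nonneg_left k3 (by positivity))))
    _ = _ := by ring

end Block

/-! ### Pathwise control over a block. -/

section Pathwise

variable {Ω : Type*} [MeasurableSpace Ω] {P : Measure Ω} {E : ℕ → Ω → ℝ} {γ : ℝ} {f α : ℕ → ℝ}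

/-- On the block `q² < k ≤ (q+1)²`, the centered sums are bounded by a constant plus `blockBound`,
uniformly in `k`. -/
lemma abs_SStar_le (hγ : 0 ≤ γ) (hind : iIndepFun (fun h : ℕ => E (h + 1)) P)
    (hE : ∀ h : ℕ, HasLaw (E (h + 1)) (expMeasure 1) P) (hf : StrictMono f) {L q k : ℕ}
    (hα : 0 ≤ α k) (hL : 1 ≤ L) (hLq : L ≤ q ^ 2) (hk1 : q ^ 2 + 1 ≤ k) (hk2 : k ≤ (q + 1) ^ 2)
    {ω : Ω} (hω : ∀ h : ℕ, 1 ≤ h → 0 ≤ E h ω) :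
    |SStar P γ f α E k ω|
      ≤ α k * (∑ j ∈ Finset.Ico 1 L, incr f j + blockBound γ (incr f) E L q ω) := by
  have ha : ∀ j, 1 ≤ j → 0 ≤ incr f j := fun j hj => (incr_pos hf hj).le
  have e0 : SStar P γ f α E k ω
      = α k * ∑ j ∈ Finset.Ico 1 k, incr f j * (expSum γ E j k ω - harmProd γ j k) := by
    rw [SStar, Finset.mul_sum]
    refine Finset.sum_congr rfl fun j hj => ?_
    rw [integral_expSum hγ hind hE k (Finset.mem_Ico.1 hj).1]
    ring
  rw [e0, abs_mul, abs_of_nonneg hα]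
  refine mul_le_mul_of_nonneg_left ?_ hα
  rw [blockBound]
  set n := q ^ 2 + 1 with hn
  set m := (q + 1) ^ 2 with hm
  have hn1 : 1 ≤ n := by omega
  have hLn : L ≤ n := by omega
  have hmn : m = n + 2 * q := by rw [hm, hn]; ring
  set V := (1 - expSum γ E n m ω) + (1 - harmProd γ n m) with hV
  have hW0 : 0 ≤ 1 - expSum γ E n m ω := sub_nonneg.2 (expSum_le_one hγ hω m hn1)
  have hw0 : 0 ≤ 1 - harmProd γ n m := sub_nonneg.2 (harmProd_le_one hγ n m)
  have hV0 : 0 ≤ V := add_nonneg hW0 hw0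
  -- S_{j,k} and its mean both lie below 1 and above their values on the whole block [n, m), so they
  -- differ by at most the sum of the two gaps.
  have hdev : ∀ j, n ≤ j → j ≤ k → |expSum γ E j k ω - harmProd γ j k| ≤ V := by
    intro j hnj hjk
    have h1 := expSum_le_one hγ hω k (hn1.trans hnj)
    have h2 := expSum_antitone_interval hγ hω hn1 hnj hk2
    have h3 := harmProd_le_one hγ j k
    have h4 : harmProd γ n m ≤ harmProd γ j k := by
      rw [← harmProd_mul_harmProd γ hnj (hjk.trans hk2), ← harmProd_mul_harmProd γ hjk hk2]
      calc _ ≤ 1 * (harmProd γ j k * 1) := mul_le_mul (harmProd_le_one hγ _ _)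
            (mul_le_mul_of_nonneg_left (harmProd_le_one hγ _ _) (harmProd_pos hγ _ _).le)
            (mul_pos (harmProd_pos hγ _ _) (harmProd_pos hγ _ _)).le zero_le_one
        _ = _ := by ring
    rw [abs_le]
    constructor <;> linarith
  rw [← Finset.sum_Ico_consecutive _ hL (hLn.trans hk1), ← Finset.sum_Ico_consecutive _ hLn hk1]
  have b1 : |∑ j ∈ Finset.Ico 1 L, incr f j * (expSum γ E j k ω - harmProd γ j k)|
      ≤ ∑ j ∈ Finset.Ico 1 L, incr f j := by
    refine (Finset.abs_sum_le_sum_abs _ _).trans (Finset.sum_le_sum fun j hj => ?_)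
    have hj1 := (Finset.mem_Ico.1 hj).1
    rw [abs_mul, abs_of_nonneg (ha j hj1)]
    refine mul_le_of_le_one_right (ha j hj1) (abs_le.2 ⟨?_, ?_⟩)
    · linarith [expSum_pos (γ := γ) (E := E) j k ω, harmProd_le_one hγ j k]
    · linarith [expSum_le_one hγ hω k hj1, harmProd_pos hγ j k]
  -- Factor both terms at n and use xy - x'y' = (x - x')y + x'(y - y'): the dependence on k is
  -- confined to the interval from n to k.
  have e2 : ∑ j ∈ Finset.Ico L n, incr f j * (expSum γ E j k ω - harmProd γ j k)
      = (∑ j ∈ Finset.Ico L n, incr f j * (expSum γ E j n ω - harmProd γ j n)) * expSum γ E n k ω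
        + (∑ j ∈ Finset.Ico L n, incr f j * harmProd γ j n)
          * (expSum γ E n k ω - harmProd γ n k) := by
    rw [Finset.sum_mul, Finset.sum_mul, ← Finset.sum_add_distrib]
    refine Finset.sum_congr rfl fun j hj => ?_
    have hjn := (Finset.mem_Ico.1 hj).2.le
    rw [← expSum_mul_expSum hjn hk1, ← harmProd_mul_harmProd γ hjn hk1]
    ring
  have hM : 0 ≤ ∑ j ∈ Finset.Ico L n, incr f j * harmProd γ j n :=
    Finset.sum_nonneg fun j hj =>
      mul_nonneg (ha j (hL.trans (Finset.mem_Ico.1 hj).1)) (harmProd_pos hγ _ _).le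
  have b2 : |∑ j ∈ Finset.Ico L n, incr f j * (expSum γ E j k ω - harmProd γ j k)|
      ≤ |∑ j ∈ Finset.Ico L n, incr f j * (expSum γ E j n ω - harmProd γ j n)|
        + (∑ j ∈ Finset.Ico L n, incr f j * harmProd γ j n) * V := by
    rw [e2]
    refine (abs_add_le _ _).trans (add_le_add ?_ ?_)
    · rw [abs_mul, abs_of_pos (expSum_pos _ _ _)]
      exact mul_le_of_le_one_right (abs_nonneg _) (expSum_le_one hγ hω k hn1)
    · rw [abs_mul, abs_of_nonneg hM]
      exact mul_le_mul_of_nonneg_left (hdev n le_rfl hk1) hM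
  have b3 : |∑ j ∈ Finset.Ico n k, incr f j * (expSum γ E j k ω - harmProd γ j k)|
      ≤ (∑ j ∈ Finset.Ico n (n + (2 * q + 1)), incr f j) * V := by
    -- The sum is extended to all of q² < j ≤ (q+1)², which removes k and matches the index range of
    -- the block hypotheses.
    refine (Finset.abs_sum_le_sum_abs _ _).trans ?_
    rw [Finset.sum_mul]
    refine (Finset.sum_le_sum fun j hj => ?_).trans
      (Finset.sum_le_sum_of_subset_of_nonneg
        (Finset.Ico_subset_Ico le_rfl (by omega : k ≤ n + (2 * q + 1)))
        (f := fun j => incr f j * V) fun j hj _ =>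
          mul_nonneg (ha j (hn1.trans (Finset.mem_Ico.1 hj).1)) hV0)
    obtain ⟨hj1, hj2⟩ := Finset.mem_Ico.1 hj
    rw [abs_mul, abs_of_nonneg (ha j (hn1.trans hj1))]
    exact mul_le_mul_of_nonneg_left (hdev j hj1 hj2.le) (ha j (hn1.trans hj1))
  refine (abs_add_le _ _).trans (add_le_add b1 ((abs_add_le _ _).trans ?_))
  linarith

end Pathwise

/-! ### Growth hypotheses turned into a bound on the block weights. -/

section WeightBound

variable {γ δ ν : ℝ} {a α : ℕ → ℝ} {L q k : ℕ}

lemma rpow_block_le (hν : 0 ≤ 1 + ν) (hνδ : 2 * (1 + ν) = 3 - δ) (hk : (k : ℝ) ≤ 4 * (q : ℝ) ^ 2) :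
    (k : ℝ) ^ (1 + ν) ≤ 4 ^ (1 + ν) * (q : ℝ) ^ (3 - δ) := by
  refine (Real.rpow_le_rpow (Nat.cast_nonneg k) hk hν).trans (le_of_eq ?_)
  rw [Real.mul_rpow (by norm_num) (by positivity), ← Real.rpow_natCast_mul (Nat.cast_nonneg q),
    ← hνδ]
  norm_num

/-- As k ≤ 4q², replacing (q²+1)^{2γ} by k^{2γ} costs only 4^{2γ}, and k^{1+ν} becomes a multiple of
q^{3-δ}. -/
lemma sq_mul_diagSum_le (hγ : 0 ≤ γ) (hν : 0 ≤ 1 + ν) (hνδ : 2 * (1 + ν) = 3 - δ) (hq : 1 ≤ q)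
    (hk1 : q ^ 2 + 1 ≤ k) (hk : (k : ℝ) ≤ 4 * (q : ℝ) ^ 2) {C : ℝ} (hC : 0 ≤ C)
    (h : α k ^ 2 / (k : ℝ) ^ (2 * γ + 1 + ν) *
        ∑ j ∈ Finset.Ico L k, a j ^ 2 * (j : ℝ) ^ (2 * γ) ≤ C) :
    α k ^ 2 * diagSum γ a L (q ^ 2 + 1)
      ≤ C * (4 ^ (2 * γ) * 4 ^ (1 + ν)) * (q : ℝ) ^ (3 - δ) := by
  have hk0 : (0 : ℝ) < k := by exact_mod_cast (by omega : 0 < k)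
  have hn0 : (0 : ℝ) < (q ^ 2 + 1 : ℕ) := by positivity
  rw [div_mul_eq_mul_div, div_le_iff₀ (by positivity)] at h
  have e : diagSum γ a L (q ^ 2 + 1) = (∑ j ∈ Finset.Ico L (q ^ 2 + 1), a j ^ 2 * (j : ℝ) ^ (2 * γ))
      / ((q ^ 2 + 1 : ℕ) : ℝ) ^ (2 * γ) := by
    rw [diagSum, Finset.sum_div]
    refine Finset.sum_congr rfl fun j _ => ?_
    rw [Real.div_rpow (Nat.cast_nonneg j) hn0.le, mul_div_assoc]
  have hsub : ∑ j ∈ Finset.Ico L (q ^ 2 + 1), a j ^ 2 * (j : ℝ) ^ (2 * γ)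
      ≤ ∑ j ∈ Finset.Ico L k, a j ^ 2 * (j : ℝ) ^ (2 * γ) :=
    Finset.sum_le_sum_of_subset_of_nonneg (Finset.Ico_subset_Ico le_rfl hk1)
      fun j _ _ => by positivity
  have hr : (k : ℝ) ^ (2 * γ) ≤ 4 ^ (2 * γ) * ((q ^ 2 + 1 : ℕ) : ℝ) ^ (2 * γ) := by
    rw [← Real.mul_rpow (by norm_num) hn0.le]
    refine Real.rpow_le_rpow hk0.le (hk.trans ?_) (by positivity)
    push_cast
    linarith
  rw [e, mul_div_assoc', div_le_iff₀ (by positivity)]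
  calc α k ^ 2 * ∑ j ∈ Finset.Ico L (q ^ 2 + 1), a j ^ 2 * (j : ℝ) ^ (2 * γ)
      ≤ C * (k : ℝ) ^ (2 * γ + 1 + ν) := (mul_le_mul_of_nonneg_left hsub (sq_nonneg _)).trans h
    _ = C * ((k : ℝ) ^ (2 * γ) * (k : ℝ) ^ (1 + ν)) := by
        rw [← Real.rpow_add hk0, add_assoc]
    _ ≤ C * ((4 ^ (2 * γ) * ((q ^ 2 + 1 : ℕ) : ℝ) ^ (2 * γ))
          * (4 ^ (1 + ν) * (q : ℝ) ^ (3 - δ))) := by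
        refine mul_le_mul_of_nonneg_left ?_ hC
        exact mul_le_mul hr (rpow_block_le hν hνδ hk) (by positivity) (by positivity)
    _ = _ := by ring

lemma sq_mul_crossSum_le (ha : ∀ j, 1 ≤ j → 0 ≤ a j) (hL : 1 ≤ L) (hν : 0 ≤ 1 + ν)
    (hνδ : 2 * (1 + ν) = 3 - δ) (hk1 : q ^ 2 + 1 ≤ k)
    (hk : (k : ℝ) ≤ 4 * (q : ℝ) ^ 2) {C : ℝ} (hC : 0 ≤ C)
    (h : α k ^ 2 / (k : ℝ) ^ (1 + ν) * ∑ j ∈ Finset.Ico (L + 1) k,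
          (∑ i ∈ Finset.Ico L j, a i) * a j * (1 / (j : ℝ)) ≤ C) :
    α k ^ 2 * crossSum a L (q ^ 2 + 1) ≤ C * 4 ^ (1 + ν) * (q : ℝ) ^ (3 - δ) := by
  have hk0 : (0 : ℝ) < k := by exact_mod_cast (by omega : 0 < k)
  rw [div_mul_eq_mul_div, div_le_iff₀ (by positivity)] at h
  have hsub : crossSum a L (q ^ 2 + 1) ≤ ∑ j ∈ Finset.Ico (L + 1) k,
      (∑ i ∈ Finset.Ico L j, a i) * a j * (1 / (j : ℝ)) := by
    have hnn : ∀ j ∈ Finset.Ico L k, 0 ≤ (∑ i ∈ Finset.Ico L j, a i) * a j * (1 / (j : ℝ)) := by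
      intro j hj
      refine mul_nonneg (mul_nonneg (Finset.sum_nonneg fun i hi => ?_) ?_) (by positivity)
      · exact ha i (hL.trans (Finset.mem_Ico.1 hi).1)
      · exact ha j (hL.trans (Finset.mem_Ico.1 hj).1)
    rcases lt_or_ge L k with hLk | hLk
    · refine (Finset.sum_le_sum_of_subset_of_nonneg (Finset.Ico_subset_Ico le_rfl hk1)
        fun j hj _ => hnn j hj).trans (le_of_eq ?_)
      -- The term j = L has an empty inner sum, so starting at L or at L + 1 is the same.
      rw [Finset.sum_eq_sum_Ico_succ_bot hLk]
      simp
    · rw [crossSum, Finset.Ico_eq_empty (by omega), Finset.Ico_eq_empty (by omega)]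
  calc _ ≤ C * (k : ℝ) ^ (1 + ν) := (mul_le_mul_of_nonneg_left hsub (sq_nonneg _)).trans h
    _ ≤ C * (4 ^ (1 + ν) * (q : ℝ) ^ (3 - δ)) :=
        mul_le_mul_of_nonneg_left (rpow_block_le hν hνδ hk) hC
    _ = _ := by ring

lemma sq_mul_sum_sq_block_le (hγ : 0 ≤ γ) (hq : 1 ≤ q) (hk1 : q ^ 2 + 1 ≤ k)
    (hk : (k : ℝ) ≤ 4 * (q : ℝ) ^ 2) {C : ℝ}
    (h : 1 / (q : ℝ) ^ (3 - δ) * ∑ i ∈ Finset.Icc 1 (2 * q + 1),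
          α k ^ 2 * a (q ^ 2 + i) ^ 2 * (((q : ℝ) ^ 2 + i) / k) ^ (2 * γ) ≤ C) :
    α k ^ 2 * ∑ j ∈ Finset.Ico (q ^ 2 + 1) (q ^ 2 + 1 + (2 * q + 1)), a j ^ 2
      ≤ C * 4 ^ (2 * γ) * (q : ℝ) ^ (3 - δ) := by
  have hk0 : (0 : ℝ) < k := by exact_mod_cast (by omega : 0 < k)
  have hq0 : (0 : ℝ) < q := by exact_mod_cast hq
  rw [one_div_mul_eq_div, div_le_iff₀ (by positivity)] at h
  have e : ∑ j ∈ Finset.Ico (q ^ 2 + 1) (q ^ 2 + 1 + (2 * q + 1)), a j ^ 2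
      = ∑ i ∈ Finset.Icc 1 (2 * q + 1), a (q ^ 2 + i) ^ 2 := by
    rw [← Finset.Ico_add_one_right_eq_Icc, Finset.sum_Ico_add (fun j => a j ^ 2), add_comm 1 (q ^ 2),
      add_comm (2 * q + 1 + 1), add_assoc, add_comm 1 (2 * q + 1)]
  rw [e]
  have hle : α k ^ 2 * ∑ i ∈ Finset.Icc 1 (2 * q + 1), a (q ^ 2 + i) ^ 2
      ≤ 4 ^ (2 * γ) * ∑ i ∈ Finset.Icc 1 (2 * q + 1),
          α k ^ 2 * a (q ^ 2 + i) ^ 2 * (((q : ℝ) ^ 2 + i) / k) ^ (2 * γ) := by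
    rw [Finset.mul_sum, Finset.mul_sum]
    refine Finset.sum_le_sum fun i _ => ?_
    rw [mul_left_comm, ← Real.mul_rpow (by norm_num) (by positivity)]
    -- Since k ≤ 4q², the base 4(q²+i)/k is at least 1, so the power can be inserted for free.
    refine le_mul_of_one_le_right (by positivity) (Real.one_le_rpow ?_ (by positivity))
    rw [mul_div_assoc', le_div_iff₀ hk0]
    have : (0 : ℝ) ≤ i := Nat.cast_nonneg i
    linarith
  refine (hle.trans (mul_le_mul_of_nonneg_left h (by positivity))).trans (le_of_eq (by ring))

lemma sq_mul_crossSum_block_le (hq : 1 ≤ q) {C : ℝ}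
    (h : α k ^ 2 / (q : ℝ) ^ (3 - δ) * ∑ j ∈ Finset.Icc 2 (2 * q + 1),
          (∑ i ∈ Finset.Ico 1 j, a (q ^ 2 + i)) * a (q ^ 2 + j) * (1 / ((q : ℝ) ^ 2 + j)) ≤ C) :
    α k ^ 2 * crossSum a (q ^ 2 + 1) (q ^ 2 + 1 + (2 * q + 1)) ≤ C * (q : ℝ) ^ (3 - δ) := by
  have hq0 : (0 : ℝ) < q := by exact_mod_cast hq
  rw [div_mul_eq_mul_div, div_le_iff₀ (by positivity)] at h
  refine (le_of_eq ?_).trans h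
  congr 1
  rw [← Finset.Ico_add_one_right_eq_Icc, crossSum, add_comm (q ^ 2) 1,
    show 1 + q ^ 2 + (2 * q + 1) = 2 * q + 1 + 1 + q ^ 2 by ring,
    ← Finset.sum_Ico_add' _ 1 (2 * q + 1 + 1) (q ^ 2),
    Finset.sum_eq_sum_Ico_succ_bot (by omega : 1 < 2 * q + 1 + 1)]
  simp only [Finset.Ico_self, Finset.sum_empty, zero_mul, zero_add]
  refine Finset.sum_congr rfl fun j _ => ?_
  rw [← Finset.sum_Ico_add' a 1 j (q ^ 2), add_comm j (q ^ 2)]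
  push_cast
  simp only [add_comm]

end WeightBound

lemma exists_sq_mul_blockWeight_le {γ δ ν : ℝ} {f α : ℕ → ℝ} {L q₀ : ℕ} (hγ : 0 ≤ γ)
    (hf : StrictMono f) (hν : 0 ≤ 1 + ν) (hνδ : 2 * (1 + ν) = 3 - δ) (hL : 1 ≤ L)
    (hLq : L ≤ q₀ ^ 2) (hq₀ : 1 ≤ q₀)
    (h1 : ∃ C : ℝ, ∀ k : ℕ, L ≤ k →
      α k ^ 2 / (k : ℝ) ^ (2 * γ + 1 + ν) *
        ∑ j ∈ Finset.Ico L k, incr f j ^ 2 * (j : ℝ) ^ (2 * γ) ≤ C)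
    (h2 : ∃ C : ℝ, ∀ k : ℕ, L ≤ k →
      α k ^ 2 / (k : ℝ) ^ (1 + ν) *
        ∑ j ∈ Finset.Ico (L + 1) k,
          (∑ i ∈ Finset.Ico L j, incr f i) * incr f j * (1 / (j : ℝ)) ≤ C)
    (h3 : ∃ C : ℝ, ∀ q k : ℕ, q₀ ≤ q → q ^ 2 + 1 ≤ k → k ≤ (q + 1) ^ 2 →
      1 / (q : ℝ) ^ (3 - δ) *
        ∑ i ∈ Finset.Icc 1 (2 * q + 1),
          α k ^ 2 * incr f (q ^ 2 + i) ^ 2 * (((q : ℝ) ^ 2 + i) / k) ^ (2 * γ) ≤ C)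
    (h4 : ∃ C : ℝ, ∀ q k : ℕ, q₀ ≤ q → q ^ 2 + 1 ≤ k → k ≤ (q + 1) ^ 2 →
      α k ^ 2 / (q : ℝ) ^ (3 - δ) *
        ∑ j ∈ Finset.Icc 2 (2 * q + 1),
          (∑ i ∈ Finset.Ico 1 j, incr f (q ^ 2 + i)) * incr f (q ^ 2 + j) *
            (1 / ((q : ℝ) ^ 2 + j)) ≤ C) :
    ∃ K : ℝ, ∀ q k : ℕ, q₀ ≤ q → q ^ 2 + 1 ≤ k → k ≤ (q + 1) ^ 2 →
      α k ^ 2 * blockWeight γ (incr f) L q ≤ K * (q : ℝ) ^ (3 - δ) := by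
  obtain ⟨C1, hC1⟩ := h1
  obtain ⟨C2, hC2⟩ := h2
  obtain ⟨C3, hC3⟩ := h3
  obtain ⟨C4, hC4⟩ := h4
  -- The first two constants multiply upper bounds for powers of k and so must be nonnegative; the
  -- other two need no sign.
  refine ⟨max C1 0 * (4 ^ (2 * γ) * 4 ^ (1 + ν)) + max C2 0 * 4 ^ (1 + ν)
    + (C3 * 4 ^ (2 * γ) + C4), fun q k hq hk1 hk2 => ?_⟩
  have hq1 : 1 ≤ q := hq₀.trans hq
  have hk : (k : ℝ) ≤ 4 * (q : ℝ) ^ 2 := by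
    have : k ≤ 4 * q ^ 2 := by nlinarith
    exact_mod_cast this
  have hLk : L ≤ k := by
    have := Nat.pow_le_pow_left hq 2
    omega
  have b1 := sq_mul_diagSum_le hγ hν hνδ hq1 hk1 hk (le_max_right C1 0)
    ((hC1 k hLk).trans (le_max_left C1 0))
  have b2 := sq_mul_crossSum_le (fun j hj => (incr_pos hf hj).le) hL hν hνδ hk1 hk
    (le_max_right C2 0) ((hC2 k hLk).trans (le_max_left C2 0))
  have b3 := sq_mul_sum_sq_block_le hγ hq1 hk1 hk (hC3 q k hq hk1 hk2)
  have b4 := sq_mul_crossSum_block_le hq1 (hC4 q k hq hk1 hk2)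
  rw [blockWeight]
  linarith

/-- The sum always contains the fixed positive term j = L, so α(k)² = O(k^{1+ν}), and 1 + ν - 2 =
-(1+δ)/2 < 0. -/
lemma tendsto_sq_div_of_bound_sum_div {δ ν : ℝ} {f α : ℕ → ℝ} {L : ℕ} (hf : StrictMono f)
    (hν : ν = (1 - δ) / 2) (hδ : 0 < δ) (hL : 1 ≤ L)
    (h : ∃ C : ℝ, ∀ k : ℕ, L ≤ k →
      α k ^ 2 / (k : ℝ) ^ (1 + ν) * ∑ j ∈ Finset.Ico L k, incr f j / (j : ℝ) ≤ C) :
    Tendsto (fun k : ℕ => α k ^ 2 / (k : ℝ) ^ 2) atTop (𝓝 0) := by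
  obtain ⟨C, hC⟩ := h
  have hd : 0 < incr f L / (L : ℝ) := div_pos (incr_pos hf hL) (by exact_mod_cast hL)
  set d := incr f L / (L : ℝ) with hdd
  have hlim : Tendsto (fun k : ℕ => C / d * (k : ℝ) ^ (-((1 + δ) / 2))) atTop (𝓝 0) := by
    have := ((tendsto_rpow_neg_atTop (by linarith : 0 < (1 + δ) / 2)).comp
      tendsto_natCast_atTop_atTop).const_mul (C / d)
    rwa [mul_zero] at this
  refine squeeze_zero' (Eventually.of_forall fun k => by positivity) ?_ hlim
  filter_upwards [eventually_ge_atTop (L + 1)] with k hk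
  have hk0 : (0 : ℝ) < k := by exact_mod_cast (by omega : 0 < k)
  have h1 : d ≤ ∑ j ∈ Finset.Ico L k, incr f j / (j : ℝ) :=
    Finset.single_le_sum (f := fun j => incr f j / (j : ℝ)) (fun j hj =>
      div_nonneg (incr_pos hf (hL.trans (Finset.mem_Ico.1 hj).1)).le (Nat.cast_nonneg j))
      (Finset.mem_Ico.2 ⟨le_rfl, hk⟩)
  have h2 := (mul_le_mul_of_nonneg_left h1
    (by positivity : 0 ≤ α k ^ 2 / (k : ℝ) ^ (1 + ν))).trans (hC k (by omega))
  rw [div_mul_eq_mul_div, div_le_iff₀ (by positivity)] at h2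
  have e : (k : ℝ) ^ (-((1 + δ) / 2)) * (k : ℝ) ^ 2 = (k : ℝ) ^ (1 + ν) := by
    rw [← Real.rpow_natCast (k : ℝ) 2, ← Real.rpow_add hk0]
    congr 1
    rw [hν]
    push_cast
    ring
  rw [div_le_iff₀ (by positivity), mul_assoc, e, div_mul_eq_mul_div, le_div_iff₀ hd]
  exact h2

/-! ### The strong law. -/

theorem proposition2 {Ω : Type*} [MeasurableSpace Ω] (P : Measure Ω) [IsProbabilityMeasure P]
    -- the i.i.d. standard exponential variables `E 1, E 2, …` (`E 0` is never used)
    (E : ℕ → Ω → ℝ)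
    (hE_indep : iIndepFun (fun h : ℕ => E (h + 1)) P)
    (hE_law : ∀ h : ℕ, HasLaw (E (h + 1)) (expMeasure 1) P)
    (f : ℕ → ℝ) (hf : StrictMono f) (hf0 : f 0 = 0)
    (γ : ℝ) (hγ : 0 < γ)
    (α : ℕ → ℝ) (hα : ∀ k : ℕ, 1 ≤ k → 0 < α k)
    (δ ν : ℝ) (hδ : 0 < δ) (hδ3 : δ < 3) (hν : ν = (1 - δ) / 2)
    (L q₀ : ℕ) (hL : 1 ≤ L) (hLq : L ≤ q₀ ^ 2)
    (h1 : ∃ C : ℝ, ∀ k : ℕ, L ≤ k →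
      α k ^ 2 / (k : ℝ) ^ (2 * γ + 1 + ν) *
        ∑ j ∈ Finset.Ico L k, incr f j ^ 2 * (j : ℝ) ^ (2 * γ) ≤ C)
    (h2 : ∃ C : ℝ, ∀ k : ℕ, L ≤ k →
      α k ^ 2 / (k : ℝ) ^ (1 + ν) *
        ∑ j ∈ Finset.Ico (L + 1) k,
          (∑ i ∈ Finset.Ico L j, incr f i) * incr f j * (1 / (j : ℝ)) ≤ C)
    (h2m : ∃ C : ℝ, ∀ k : ℕ, L ≤ k →
      α k ^ 2 / (k : ℝ) ^ (1 + ν) * ∑ j ∈ Finset.Ico L k, incr f j / (j : ℝ) ≤ C)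
    (h3 : ∃ C : ℝ, ∀ q k : ℕ, q₀ ≤ q → q ^ 2 + 1 ≤ k → k ≤ (q + 1) ^ 2 →
      1 / (q : ℝ) ^ (3 - δ) *
        ∑ i ∈ Finset.Icc 1 (2 * q + 1),
          α k ^ 2 * incr f (q ^ 2 + i) ^ 2 * (((q : ℝ) ^ 2 + i) / k) ^ (2 * γ) ≤ C)
    (h4 : ∃ C : ℝ, ∀ q k : ℕ, q₀ ≤ q → q ^ 2 + 1 ≤ k → k ≤ (q + 1) ^ 2 →
      α k ^ 2 / (q : ℝ) ^ (3 - δ) *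
        ∑ j ∈ Finset.Icc 2 (2 * q + 1),
          (∑ i ∈ Finset.Ico 1 j, incr f (q ^ 2 + i)) * incr f (q ^ 2 + j) *
            (1 / ((q : ℝ) ^ 2 + j)) ≤ C) :
    (∀ᵐ ω ∂P, Tendsto (fun k : ℕ => SStar P γ f α E k ω / (k : ℝ)) atTop (𝓝 0)) ∧
    (∀ m : ℝ, Tendsto (fun k : ℕ => centeringMean P γ f α E k) atTop (𝓝 m) →
      ∀ᵐ ω ∂P, Tendsto (fun k : ℕ => uncenteredMean γ f α E k ω) atTop (𝓝 m)) := by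
  have ha : ∀ j, 1 ≤ j → 0 < incr f j := fun j hj => incr_pos hf hj
  have hq0 : 1 ≤ q₀ := by
    by_contra h
    have : q₀ = 0 := by omega
    subst this
    simp at hLq
    omega
  have hν0 : 0 ≤ 1 + ν := by rw [hν]; linarith
  have hνδ : 2 * (1 + ν) = 3 - δ := by rw [hν]; ring
  have hmain : ∀ᵐ ω ∂P, Tendsto (fun k : ℕ => SStar P γ f α E k ω / (k : ℝ)) atTop (𝓝 0) := by
    obtain ⟨KR, hKR⟩ := integral_blockBound_sq_le hγ.le hE_indep hE_law (fun j hj => (ha j hj).le) hL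
    obtain ⟨KW, hKW⟩ := exists_sq_mul_blockWeight_le hγ.le hf hν0 hνδ hL hLq hq0 h1 h2 h3 h4
    -- Dividing by the weight cancels it from the second-moment bound and leaves the summable
    -- q^{-1-δ}. The shift to q + 1 is there because the block estimates need q ≥ 1.
    have hae : ∀ᵐ ω ∂P, Tendsto (fun q : ℕ => ((q + 1 : ℕ) : ℝ) ^ (-1 - δ)
        / blockWeight γ (incr f) L (q + 1) * blockBound γ (incr f) E L (q + 1) ω ^ 2)
        atTop (𝓝 0) := by
      have hsum : Summable fun q : ℕ => KR * ((q + 1 : ℕ) : ℝ) ^ (-1 - δ) :=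
        ((summable_nat_add_iff 1).2 (Real.summable_nat_rpow.2 (by linarith))).mul_left KR
      refine ae_tendsto_zero_of_summable_integral (fun q ω => ?_) (fun q => ?_) (fun q => ?_) hsum
      · have := blockWeight_pos (γ := γ) ha hL (q + 1)
        positivity
      · exact (hKR (q + 1) (Nat.le_add_left 1 q)).1.const_mul _
      · have hw := blockWeight_pos (γ := γ) ha hL (q + 1)
        rw [integral_const_mul]
        refine (mul_le_mul_of_nonneg_left (hKR (q + 1) (Nat.le_add_left 1 q)).2
          (by positivity)).trans (le_of_eq ?_)
        field_simp
    filter_upwards [hae, ae_nonneg_of_hasLaw_exp hE_law] with ω hω hE0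
    have hu : Tendsto (fun q : ℕ => (q : ℝ) ^ (-1 - δ) / blockWeight γ (incr f) L q
        * blockBound γ (incr f) E L q ω ^ 2) atTop (𝓝 0) :=
      (tendsto_add_atTop_iff_nat (f := fun q : ℕ => (q : ℝ) ^ (-1 - δ)
        / blockWeight γ (incr f) L q * blockBound γ (incr f) E L q ω ^ 2) 1).1 hω
    -- The block index of k; with k - 1 instead of k, the endpoint k = (q+1)² stays in block q.
    have hsqrt : Tendsto (fun k : ℕ => Nat.sqrt (k - 1)) atTop atTop := by
      refine tendsto_atTop.2 fun b => ?_
      filter_upwards [eventually_ge_atTop (b * b + 1)] with k hk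
      exact Nat.le_sqrt.2 (by omega)
    have hsum := ((tendsto_sq_div_of_bound_sum_div hf hν hδ hL h2m).const_mul
      (2 * (∑ j ∈ Finset.Ico 1 L, incr f j) ^ 2)).add ((hu.comp hsqrt).const_mul (2 * KW))
    rw [mul_zero, mul_zero, add_zero] at hsum
    have hsq : Tendsto (fun k : ℕ => (SStar P γ f α E k ω / (k : ℝ)) ^ 2) atTop (𝓝 0) := by
      refine squeeze_zero' (Eventually.of_forall fun k => sq_nonneg _) ?_ hsum
      filter_upwards [eventually_ge_atTop (q₀ * q₀ + 1)] with k hk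
      simp only [Function.comp_apply]
      set q := Nat.sqrt (k - 1) with hq
      have hqq : q₀ ≤ q := Nat.le_sqrt.2 (by omega)
      have hk1 : q ^ 2 + 1 ≤ k := by
        have := Nat.sqrt_le' (k - 1)
        rw [← hq] at this
        omega
      have hk2 : k ≤ (q + 1) ^ 2 := by
        have := Nat.lt_succ_sqrt' (k - 1)
        rw [← hq, Nat.succ_eq_add_one] at this
        omega
      have hq1 : (0 : ℝ) < q := by exact_mod_cast hq0.trans hqq
      have hk0 : (0 : ℝ) < k := by exact_mod_cast (by omega : 0 < k)
      have hb := abs_SStar_le hγ.le hE_indep hE_law hf (α := α) (hα k (by omega)).le hL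
        (hLq.trans (Nat.pow_le_pow_left hqq 2)) hk1 hk2 hE0
      have hw := blockWeight_pos (γ := γ) ha hL q
      have hKq := hKW q k hqq hk1 hk2
      set A := ∑ j ∈ Finset.Ico 1 L, incr f j
      set R := blockBound γ (incr f) E L q ω
      set w := blockWeight γ (incr f) L q
      have hb2 : SStar P γ f α E k ω ^ 2 ≤ 2 * A ^ 2 * α k ^ 2 + 2 * (α k ^ 2 * R ^ 2) := by
        rw [← sq_abs]
        refine (pow_le_pow_left₀ (abs_nonneg _) hb 2).trans ?_
        rw [mul_pow]
        nlinarith [mul_le_mul_of_nonneg_left (add_sq_le (a := A) (b := R)) (sq_nonneg (α k))]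
      have hR : α k ^ 2 * R ^ 2 / (k : ℝ) ^ 2 ≤ KW * ((q : ℝ) ^ (-1 - δ) / w * R ^ 2) := by
        have h4q : (q : ℝ) ^ (3 - δ) = (q : ℝ) ^ (-1 - δ) * (q : ℝ) ^ 4 := by
          rw [← Real.rpow_natCast (q : ℝ) 4, ← Real.rpow_add hq1]
          congr 1
          push_cast
          ring
        have hkq : (q : ℝ) ^ 4 ≤ (k : ℝ) ^ 2 := by
          have : (q : ℝ) ^ 2 ≤ k := by exact_mod_cast (Nat.le_succ _).trans hk1
          calc (q : ℝ) ^ 4 = ((q : ℝ) ^ 2) ^ 2 := by ring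
            _ ≤ _ := pow_le_pow_left₀ (by positivity) this 2
        have hKW0 : 0 ≤ KW * (q : ℝ) ^ (-1 - δ) := by
          have h0 : 0 ≤ KW * (q : ℝ) ^ (3 - δ) := le_trans (by positivity) hKq
          have h0' : 0 ≤ KW := nonneg_of_mul_nonneg_left h0 (by positivity)
          positivity
        -- Here q^{3-δ} = q^{-1-δ} q⁴ and q⁴ ≤ k²: the division by k² yields the summable exponent.
        have hα2 : α k ^ 2 ≤ KW * (q : ℝ) ^ (-1 - δ) * (k : ℝ) ^ 2 / w := by
          rw [le_div_iff₀ hw]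
          refine hKq.trans ?_
          rw [h4q, ← mul_assoc]
          exact mul_le_mul_of_nonneg_left hkq hKW0
        rw [div_le_iff₀ (by positivity)]
        refine (mul_le_mul_of_nonneg_right hα2 (sq_nonneg R)).trans (le_of_eq (by ring))
      rw [div_pow, div_le_iff₀ (by positivity)]
      rw [div_le_iff₀ (by positivity)] at hR
      have hA : 2 * A ^ 2 * (α k ^ 2 / (k : ℝ) ^ 2) * (k : ℝ) ^ 2 = 2 * A ^ 2 * α k ^ 2 := by
        field_simp
      rw [add_mul, hA]
      linarith
    have := hsq.sqrt
    simp only [Real.sqrt_sq_eq_abs, Real.sqrt_zero] at this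
    exact (tendsto_zero_iff_abs_tendsto_zero _).2 this
  -- The uncentered mean is exactly S*_k/k plus the deterministic centering mean.
  refine ⟨hmain, fun μ hμ => ?_⟩
  filter_upwards [hmain] with ω hω
  have h := hω.add hμ
  rw [zero_add] at h
  refine h.congr fun k => ?_
  rw [SStar, centeringMean, uncenteredMean, div_eq_inv_mul, ← mul_add, ← Finset.sum_add_distrib]
  congr 1
  exact Finset.sum_congr rfl fun j _ => by ring
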